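/- Let $n\ge 0$, let $V$ be a real inner product space of dimension $2n+2$ with unit sphere $S^{2n+1}$, and let $\mathrm{Gr}^+_2(V)$ be the smooth manifold of oriented $2$-planes in $V$; its tangent space at $P$ is canonically $\mathrm{Lin}(P,V/P)$. Let $X$ be a smooth manifold (Hausdorff, second countable) of dimension $2n$ and let $\iota\colon X\to \mathrm{Gr}^+_2(V)$ be an immersed submanifold, i.e. a smooth map with injective differential at every point. For $x\in X$ with $P=\iota(x)$, let $U_P\subset \mathrm{Lin}(P,V/P)$ be the image of $T_xX$ under $d\iota_x$, and define $\alpha_P\colon P\to \mathrm{Lin}(U_P,V/P)$ by $\alpha_P(p)(u)=u(p)$. The polynomial $\xi_P(p)=\det\alpha_P(p)=\Lambda^{2n}\alpha_P(p)\in \mathrm{Lin}(\Lambda^{2n}U_P,\Lambda^{2n}(V/P))$, extended to $P\otimes_{\mathbb R}\mathbb C$, cuts out the characteristic variety $\Xi_x$ in the complex projective line $\mathbb P(P\otimes_{\mathbb R}\mathbb C)$. The submanifold is called elliptic if, for every $x\in X$, $\Xi_x$ contains no real point, i.e. no point $[p\otimes 1]$ with $0\ne p\in P$. We say that $X$ (via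 $\iota$) is the base of a great circle fibration if there is a smooth fibre bundle $\pi\colon S^{2n+1}\to X$ with fibre the circle, all of whose fibres are great circles, such that for every $x\in X$ the fibre $\pi^{-1}(x)$ is the great circle $S^{2n+1}\cap\iota(x)$. Proposition. $X$ is the base of a great circle fibration if and only if $X$ is compact and connected (in particular non-empty) and $\iota$ is elliptic. -/

import Mathlib

open Metric Module Function Set Topology
open scoped Manifold ContDiff TensorProduct LinearAlgebra.Projectivization

noncomputable section

/-! ## The Grassmannian of oriented 2-planes as a smooth manifold -/

/-- An oriented 2-plane in the real vector space `V`. -/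
@[ext]
structure OrientedPlane (V : Type*) [NormedAddCommGroup V] [NormedSpace ℝ V] where
  plane : Submodule ℝ V
  finrank_plane : finrank ℝ plane = 2
  orientation : Orientation ℝ plane (Fin 2)

/-- The frames of `V`: injective linear maps `ℝ² → V`. -/
abbrev PlaneFrame (V : Type*) [NormedAddCommGroup V] [NormedSpace ℝ V] : Type _ :=
  {f : (Fin 2 → ℝ) →L[ℝ] V // Injective f}

namespace OrientedPlane

variable {V : Type*} [NormedAddCommGroup V] [NormedSpace ℝ V] {m : ℕ}

/-- The image of the standardly oriented `ℝ²` under an injective linear map. -/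
def ofFrame (f : PlaneFrame V) : OrientedPlane V where
  plane := LinearMap.range (f.1 : (Fin 2 → ℝ) →ₗ[ℝ] V)
  finrank_plane := by
    rw [LinearMap.finrank_range_of_inj f.2]
    simp
  orientation :=
    Orientation.map (Fin 2) (LinearEquiv.ofInjective (f.1 : (Fin 2 → ℝ) →ₗ[ℝ] V) f.2)
      (Pi.basisFun ℝ (Fin 2)).orientation

/-- An injective linear map, as an isomorphism onto its image. -/
def frameEquiv (f : PlaneFrame V) : (Fin 2 → ℝ) ≃ₗ[ℝ] (ofFrame f).plane :=
  LinearEquiv.ofInjective (f.1 : (Fin 2 → ℝ) →ₗ[ℝ] V) f.2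

theorem frameEquiv_apply (f : PlaneFrame V) (x : Fin 2 → ℝ) : (frameEquiv f x : V) = f.1 x := rfl

theorem ofFrame_orientation (f : PlaneFrame V) : (ofFrame f).orientation =
    Orientation.map (Fin 2) (frameEquiv f) (Pi.basisFun ℝ (Fin 2)).orientation := rfl

theorem ext_of_map {P Q : OrientedPlane V} (h : P.plane = Q.plane)
    (ho : Orientation.map (Fin 2) (LinearEquiv.ofEq _ _ h) P.orientation = Q.orientation) :
    P = Q := by
  obtain ⟨P, hP, o⟩ := P
  obtain ⟨Q, hQ, o'⟩ := Q
  simp only at h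
  subst h
  have : LinearEquiv.ofEq P P rfl = LinearEquiv.refl ℝ P := rfl
  rw [this, Orientation.map_refl] at ho
  simpa using ho

theorem map_trans {M N L : Type*} [AddCommGroup M] [Module ℝ M] [AddCommGroup N] [Module ℝ N]
    [AddCommGroup L] [Module ℝ L] (e : M ≃ₗ[ℝ] N) (e' : N ≃ₗ[ℝ] L) (o : Orientation ℝ M (Fin 2)) :
    Orientation.map (Fin 2) e' (Orientation.map (Fin 2) e o) =
      Orientation.map (Fin 2) (e.trans e') o := by
  induction o using Module.Ray.ind with
  | h v hv =>
    simp only [Orientation.map_apply]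
    rfl

theorem ofFrame_comp (f g : PlaneFrame V) (h : (Fin 2 → ℝ) ≃L[ℝ] (Fin 2 → ℝ))
    (hd : 0 < LinearMap.det (h : (Fin 2 → ℝ) →ₗ[ℝ] (Fin 2 → ℝ)))
    (hg : ∀ x, g.1 x = f.1 (h x)) : ofFrame g = ofFrame f := by
  have hr : (ofFrame g).plane = (ofFrame f).plane := by
    apply le_antisymm
    · rintro _ ⟨x, rfl⟩
      exact ⟨h x, (hg x).symm⟩
    · rintro _ ⟨x, rfl⟩
      exact ⟨h.symm x, by simpa using hg (h.symm x)⟩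
  refine ext_of_map hr ?_
  have key : Orientation.map (Fin 2) h.toLinearEquiv (Pi.basisFun ℝ (Fin 2)).orientation =
      (Pi.basisFun ℝ (Fin 2)).orientation :=
    (Orientation.map_eq_iff_det_pos _ _ (by simp)).2 hd
  rw [ofFrame_orientation, ofFrame_orientation, map_trans]
  conv_rhs => rw [← key]
  rw [map_trans]
  congr 2
  ext x : 1
  exact Subtype.ext (hg x)

theorem exists_of_ofFrame_eq {f g : PlaneFrame V} (hfg : ofFrame g = ofFrame f) :
    ∃ h : (Fin 2 → ℝ) ≃L[ℝ] (Fin 2 → ℝ),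
      0 < LinearMap.det (h : (Fin 2 → ℝ) →ₗ[ℝ] (Fin 2 → ℝ)) ∧ ∀ x, g.1 x = f.1 (h x) := by
  have hr : (ofFrame g).plane = (ofFrame f).plane := by rw [hfg]
  have ho : Orientation.map (Fin 2) (LinearEquiv.ofEq _ _ hr) (ofFrame g).orientation =
      (ofFrame f).orientation := by
    have aux : ∀ {P Q : OrientedPlane V} (e : P = Q) (h : P.plane = Q.plane),
        Orientation.map (Fin 2) (LinearEquiv.ofEq _ _ h) P.orientation = Q.orientation := by
      intro P Q e h
      subst e
      have : LinearEquiv.ofEq P.plane P.plane h = LinearEquiv.refl ℝ P.plane := rfl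
      rw [this, Orientation.map_refl]
      rfl
    exact aux hfg hr
  let h : (Fin 2 → ℝ) ≃ₗ[ℝ] (Fin 2 → ℝ) :=
    ((frameEquiv g).trans (LinearEquiv.ofEq _ _ hr)).trans (frameEquiv f).symm
  refine ⟨h.toContinuousLinearEquiv, ?_, fun x => ?_⟩
  · refine (Orientation.map_eq_iff_det_pos (Pi.basisFun ℝ (Fin 2)).orientation h (by simp)).1 ?_
    rw [← map_trans, ← map_trans, ← Orientation.map_symm, Equiv.symm_apply_eq]
    exact ho
  · have : frameEquiv f (h x) = LinearEquiv.ofEq _ _ hr (frameEquiv g x) := by simp [h]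
    exact (congrArg Subtype.val this).symm

theorem ofFrame_surjective : Surjective (ofFrame : PlaneFrame V → OrientedPlane V) := by
  intro P
  have hP : Fintype.card (Fin 2) = finrank ℝ P.plane := by simp [P.finrank_plane]
  have : FiniteDimensional ℝ P.plane :=
    Module.finite_of_finrank_pos (by rw [P.finrank_plane]; norm_num)
  let b := P.orientation.someBasis hP
  let e : (Fin 2 → ℝ) ≃ₗ[ℝ] P.plane := b.equivFun.symm
  let f : (Fin 2 → ℝ) →L[ℝ] V := LinearMap.toContinuousLinearMap (P.plane.subtype ∘ₗ e.toLinearMap)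
  have hf : Injective f := Subtype.val_injective.comp e.injective
  have hr : (ofFrame ⟨f, hf⟩).plane = P.plane := by
    apply le_antisymm
    · rintro _ ⟨x, rfl⟩
      exact (e x).2
    · intro v hv
      exact ⟨e.symm ⟨v, hv⟩, by simp [f]⟩
  refine ⟨⟨f, hf⟩, ext_of_map hr ?_⟩
  have hb : b.orientation = P.orientation := P.orientation.someBasis_orientation hP
  rw [← hb]
  have he : b = (Pi.basisFun ℝ (Fin 2)).map e := by
    ext i
    simp [e]
  rw [he, Basis.orientation_map, ofFrame_orientation, map_trans]
  have h2 : (frameEquiv ⟨f, hf⟩).trans (LinearEquiv.ofEq _ _ hr) = e := by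
    ext x : 1
    exact Subtype.ext rfl
  rw [h2]

/-- The Grassmannian carries the quotient topology of the space of frames. -/
instance : TopologicalSpace (OrientedPlane V) :=
  TopologicalSpace.coinduced ofFrame inferInstance

theorem isQuotientMap_ofFrame : IsQuotientMap (ofFrame : PlaneFrame V → OrientedPlane V) :=
  ⟨⟨rfl⟩, ofFrame_surjective⟩

/-- First component of linear coordinates `V ≃ ℝ² × ℝᵐ`. -/
def xPart (φ : V ≃L[ℝ] (Fin 2 → ℝ) × (Fin m → ℝ)) : V →L[ℝ] (Fin 2 → ℝ) :=
  (ContinuousLinearMap.fst ℝ (Fin 2 → ℝ) (Fin m → ℝ)).comp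
    (φ : V →L[ℝ] (Fin 2 → ℝ) × (Fin m → ℝ))

@[simp]
theorem xPart_apply (φ : V ≃L[ℝ] (Fin 2 → ℝ) × (Fin m → ℝ)) (v : V) : xPart φ v = (φ v).1 := rfl

/-- Second component of linear coordinates `V ≃ ℝ² × ℝᵐ`. -/
def yPart (φ : V ≃L[ℝ] (Fin 2 → ℝ) × (Fin m → ℝ)) : V →L[ℝ] (Fin m → ℝ) :=
  (ContinuousLinearMap.snd ℝ (Fin 2 → ℝ) (Fin m → ℝ)).comp
    (φ : V →L[ℝ] (Fin 2 → ℝ) × (Fin m → ℝ))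

@[simp]
theorem yPart_apply (φ : V ≃L[ℝ] (Fin 2 → ℝ) × (Fin m → ℝ)) (v : V) : yPart φ v = (φ v).2 := rfl

/-- The matrix `p` of the plane `P` written as a graph `y = p x` in the coordinates `φ = (x, y)`. -/
def slope (φ : V ≃L[ℝ] (Fin 2 → ℝ) × (Fin m → ℝ)) (P : OrientedPlane V) :
    (Fin 2 → ℝ) →L[ℝ] (Fin m → ℝ) :=
  ((yPart φ).comp P.plane.subtypeL).comp ((xPart φ).comp P.plane.subtypeL).inverse

/-- The frame `x ↦ (x, p x)` of the graph `y = p x`. -/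
def graphFrame (φ : V ≃L[ℝ] (Fin 2 → ℝ) × (Fin m → ℝ)) (p : (Fin 2 → ℝ) →L[ℝ] (Fin m → ℝ)) :
    PlaneFrame V :=
  ⟨(φ.symm : _ →L[ℝ] V).comp ((ContinuousLinearMap.id ℝ _).prod p), fun a b h => by
    have := φ.symm.injective h
    exact congrArg Prod.fst this⟩

theorem slope_ofFrame (φ : V ≃L[ℝ] (Fin 2 → ℝ) × (Fin m → ℝ)) (f : PlaneFrame V) :
    slope φ (ofFrame f) = ((yPart φ).comp f.1).comp ((xPart φ).comp f.1).inverse := by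
  let e : (Fin 2 → ℝ) ≃L[ℝ] (ofFrame f).plane :=
    (LinearEquiv.ofInjective (f.1 : (Fin 2 → ℝ) →ₗ[ℝ] V) f.2).toContinuousLinearEquiv
  have he : f.1 = (ofFrame f).plane.subtypeL.comp (e : _ →L[ℝ] (ofFrame f).plane) := rfl
  conv_rhs => rw [he, ← ContinuousLinearMap.comp_assoc, ← ContinuousLinearMap.comp_assoc,
    ContinuousLinearMap.inverse_comp_equiv]
  ext x : 1
  simp [slope]

/-- The frames whose projection to the `x`-plane is an orientation preserving isomorphism. -/
def posFrames (φ : V ≃L[ℝ] (Fin 2 → ℝ) × (Fin m → ℝ)) : Set (PlaneFrame V) :=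
  {f | 0 < ((xPart φ).comp f.1).det}

theorem mem_posFrames (φ : V ≃L[ℝ] (Fin 2 → ℝ) × (Fin m → ℝ)) (f : PlaneFrame V) :
    f ∈ posFrames φ ↔ 0 < ((xPart φ).comp f.1).det := Iff.rfl

theorem preimage_image_posFrames (φ : V ≃L[ℝ] (Fin 2 → ℝ) × (Fin m → ℝ)) :
    ofFrame ⁻¹' (ofFrame '' posFrames φ) = posFrames φ := by
  refine subset_antisymm ?_ (subset_preimage_image _ _)
  rintro g ⟨f, hf, hfg⟩
  obtain ⟨h, hd, hx⟩ := exists_of_ofFrame_eq hfg.symm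
  have : (xPart φ).comp g.1 = ((xPart φ).comp f.1).comp (h : _ →L[ℝ] _) := by
    ext x : 1
    simp [hx]
  have h2 : ((xPart φ).comp g.1).det =
      ((xPart φ).comp f.1).det * LinearMap.det (h : (Fin 2 → ℝ) →ₗ[ℝ] (Fin 2 → ℝ)) := by
    rw [this]
    exact LinearMap.det_comp _ _
  rw [mem_posFrames, h2]
  exact mul_pos hf hd

theorem isInvertible_of_det {A : (Fin 2 → ℝ) →L[ℝ] (Fin 2 → ℝ)} (hA : 0 < A.det) :
    ∃ h : (Fin 2 → ℝ) ≃L[ℝ] (Fin 2 → ℝ), (h : _ →L[ℝ] _) = A :=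
  ⟨A.toContinuousLinearEquivOfDetNeZero hA.ne', by ext x : 1; simp⟩

theorem graphFrame_mem (φ : V ≃L[ℝ] (Fin 2 → ℝ) × (Fin m → ℝ))
    (p : (Fin 2 → ℝ) →L[ℝ] (Fin m → ℝ)) : graphFrame φ p ∈ posFrames φ := by
  have : (xPart φ).comp (graphFrame φ p).1 = ContinuousLinearMap.id ℝ _ := by
    ext x : 1
    simp [graphFrame]
  rw [mem_posFrames, this]
  have : (ContinuousLinearMap.id ℝ (Fin 2 → ℝ)).det = 1 := LinearMap.det_id
  rw [this]
  exact one_pos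

theorem slope_graphFrame (φ : V ≃L[ℝ] (Fin 2 → ℝ) × (Fin m → ℝ))
    (p : (Fin 2 → ℝ) →L[ℝ] (Fin m → ℝ)) : slope φ (ofFrame (graphFrame φ p)) = p := by
  rw [slope_ofFrame]
  have h1 : (xPart φ).comp (graphFrame φ p).1 = ContinuousLinearMap.id ℝ _ := by
    ext x : 1
    simp [graphFrame]
  have h2 : (yPart φ).comp (graphFrame φ p).1 = p := by
    ext x : 1
    simp [graphFrame]
  rw [h1, h2, ContinuousLinearMap.inverse_id]
  exact ContinuousLinearMap.comp_id _

theorem ofFrame_graphFrame_slope (φ : V ≃L[ℝ] (Fin 2 → ℝ) × (Fin m → ℝ)) {f : PlaneFrame V}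
    (hf : f ∈ posFrames φ) : ofFrame (graphFrame φ (slope φ (ofFrame f))) = ofFrame f := by
  obtain ⟨h, hh⟩ := isInvertible_of_det hf
  refine (ofFrame_comp _ _ h ?_ fun x => ?_).symm
  · have : 0 < (h : (Fin 2 → ℝ) →L[ℝ] (Fin 2 → ℝ)).det := by rw [hh]; exact hf
    exact this
  · rw [slope_ofFrame, ← hh, ContinuousLinearMap.inverse_equiv]
    have hx : h x = (φ (f.1 x)).1 := (congrArg (fun A : (Fin 2 → ℝ) →L[ℝ] (Fin 2 → ℝ) => A x) hh :)
    have hy : h.symm (h x) = x := h.symm_apply_apply x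
    apply φ.injective
    refine (Prod.ext ?_ ?_ : _ = (h x, (φ (f.1 (h.symm (h x)))).2)).trans ?_
    · exact hx.symm
    · rw [hy]
    · simp [graphFrame]

theorem contDiff_graphFrame (φ : V ≃L[ℝ] (Fin 2 → ℝ) × (Fin m → ℝ)) :
    ContDiff ℝ ∞ (fun p : (Fin 2 → ℝ) →L[ℝ] (Fin m → ℝ) => (graphFrame φ p).1) := by
  have h : (fun p : (Fin 2 → ℝ) →L[ℝ] (Fin m → ℝ) => (graphFrame φ p).1) = fun p =>
      (φ.symm : (Fin 2 → ℝ) × (Fin m → ℝ) →L[ℝ] V).comp (ContinuousLinearMap.inl ℝ _ _) +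
        ((φ.symm : (Fin 2 → ℝ) × (Fin m → ℝ) →L[ℝ] V).comp
          (ContinuousLinearMap.inr ℝ _ _)).comp p := by
    funext p
    ext x : 1
    simp [graphFrame, ← map_add]
  rw [h]
  exact contDiff_const.add (contDiff_const.clm_comp contDiff_id)

theorem isOpen_image_posFrames (φ : V ≃L[ℝ] (Fin 2 → ℝ) × (Fin m → ℝ)) :
    IsOpen (ofFrame '' posFrames φ : Set (OrientedPlane V)) := by
  rw [← isQuotientMap_ofFrame.isOpen_preimage, preimage_image_posFrames]
  refine isOpen_lt continuous_const ?_
  exact ContinuousLinearMap.continuous_det.comp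
    ((ContinuousLinearMap.compL ℝ _ _ _ (xPart φ)).continuous.comp continuous_subtype_val)

/-- The chart `P ↦ p` on the open set of the oriented planes of the form `y = p x`, oriented by `x`,
in the linear coordinates `φ = (x, y)` of `V`. -/
def graphChart (φ : V ≃L[ℝ] (Fin 2 → ℝ) × (Fin m → ℝ)) :
    OpenPartialHomeomorph (OrientedPlane V) ((Fin 2 → ℝ) →L[ℝ] (Fin m → ℝ)) where
  toFun := slope φ
  invFun p := ofFrame (graphFrame φ p)
  source := ofFrame '' posFrames φ
  target := univ
  map_source' _ _ := mem_univ _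
  map_target' p _ := ⟨_, graphFrame_mem φ p, rfl⟩
  left_inv' := by
    rintro _ ⟨f, hf, rfl⟩
    exact ofFrame_graphFrame_slope φ hf
  right_inv' p _ := slope_graphFrame φ p
  open_source := isOpen_image_posFrames φ
  open_target := isOpen_univ
  continuousOn_toFun := by
    rw [isQuotientMap_ofFrame.continuousOn_isOpen_iff (isOpen_image_posFrames φ),
      preimage_image_posFrames]
    have : (slope φ ∘ ofFrame : PlaneFrame V → _) =
        fun f => ((yPart φ).comp f.1).comp ((xPart φ).comp f.1).inverse :=
      funext fun f => slope_ofFrame φ f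
    rw [this]
    intro f hf
    apply ContinuousAt.continuousWithinAt
    obtain ⟨h, hh⟩ := isInvertible_of_det hf
    have h1 : ContinuousAt (fun f : PlaneFrame V => (xPart φ).comp f.1) f :=
      ((ContinuousLinearMap.compL ℝ _ _ _ (xPart φ)).continuous.comp
        continuous_subtype_val).continuousAt
    have h2 : ContinuousAt (fun f : PlaneFrame V => (yPart φ).comp f.1) f :=
      ((ContinuousLinearMap.compL ℝ _ _ _ (yPart φ)).continuous.comp
        continuous_subtype_val).continuousAt
    have h3 : ContinuousAt (fun f : PlaneFrame V => ((xPart φ).comp f.1).inverse) f := by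
      refine ContinuousAt.comp (f := fun f : PlaneFrame V => (xPart φ).comp f.1)
        (g := ContinuousLinearMap.inverse) ?_ h1
      show ContinuousAt _ ((xPart φ).comp f.1)
      rw [← hh]
      exact (contDiffAt_map_inverse (n := 0) h).continuousAt
    exact h2.clm_comp h3
  continuousOn_invFun := by
    apply Continuous.continuousOn
    exact isQuotientMap_ofFrame.continuous.comp
      (Continuous.subtype_mk (contDiff_graphFrame φ).continuous _)

/-- Linear coordinates in which the oriented plane `P` is the oriented plane `y = 0`. -/
theorem exists_adapted [Fact (finrank ℝ V = m + 1 + 1)] (P : OrientedPlane V) :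
    ∃ φ : V ≃L[ℝ] (Fin 2 → ℝ) × (Fin m → ℝ),
      P ∈ (graphChart φ).source ∧ P.plane = LinearMap.ker (yPart φ : V →ₗ[ℝ] (Fin m → ℝ)) := by
  have hV : finrank ℝ V = m + 1 + 1 := Fact.out
  have : FiniteDimensional ℝ V := Module.finite_of_finrank_pos (by omega)
  obtain ⟨f, rfl⟩ := ofFrame_surjective P
  obtain ⟨Q, hQ⟩ := (ofFrame f).plane.exists_isCompl
  have hQd : finrank ℝ Q = finrank ℝ (Fin m → ℝ) := by
    have := Submodule.finrank_add_eq_of_isCompl hQ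
    rw [(ofFrame f).finrank_plane] at this
    simp
    omega
  let φ : V ≃ₗ[ℝ] (Fin 2 → ℝ) × (Fin m → ℝ) :=
    (Submodule.prodEquivOfIsCompl _ _ hQ).symm.trans
      (LinearEquiv.prodCongr (frameEquiv f).symm (LinearEquiv.ofFinrankEq _ _ hQd))
  have hφ : ∀ x, φ (f.1 x) = (x, 0) := by
    intro x
    have h1 : (Submodule.prodEquivOfIsCompl _ _ hQ).symm (f.1 x) = (frameEquiv f x, 0) :=
      Submodule.prodEquivOfIsCompl_symm_apply_left _ _ hQ (frameEquiv f x)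
    simp [φ, h1]
  refine ⟨φ.toContinuousLinearEquiv, ⟨f, ?_, rfl⟩, ?_⟩
  · have : (xPart φ.toContinuousLinearEquiv).comp f.1 = ContinuousLinearMap.id ℝ _ := by
      ext x : 1
      show (φ (f.1 x)).1 = x
      rw [hφ]
    rw [mem_posFrames, this]
    have : (ContinuousLinearMap.id ℝ (Fin 2 → ℝ)).det = 1 := LinearMap.det_id
    rw [this]
    exact one_pos
  · apply le_antisymm
    · rintro _ ⟨x, rfl⟩
      show (φ (f.1 x)).2 = 0
      rw [hφ]
    · intro v hv
      refine ⟨(φ v).1, φ.injective ?_⟩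
      have : (φ v).2 = 0 := hv
      show φ (f.1 _) = _
      rw [hφ]
      exact Prod.ext rfl this.symm

/-- A choice of linear coordinates `(x, y)` of `V` in which `P` is cut out by `y = 0` and oriented
by `x`. -/
def adapted [Fact (finrank ℝ V = m + 1 + 1)] (P : OrientedPlane V) :
    V ≃L[ℝ] (Fin 2 → ℝ) × (Fin m → ℝ) :=
  (exists_adapted P).choose

instance [Fact (finrank ℝ V = m + 1 + 1)] :
    ChartedSpace ((Fin 2 → ℝ) →L[ℝ] (Fin m → ℝ)) (OrientedPlane V) where
  atlas := range graphChart
  chartAt P := graphChart (adapted P)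
  mem_chart_source P := (exists_adapted P).choose_spec.1
  chart_mem_atlas _ := ⟨_, rfl⟩

instance [Fact (finrank ℝ V = m + 1 + 1)] :
    IsManifold 𝓘(ℝ, (Fin 2 → ℝ) →L[ℝ] (Fin m → ℝ)) ∞ (OrientedPlane V) := by
  apply isManifold_of_contDiffOn
  rintro _ _ ⟨φ, rfl⟩ ⟨ψ, rfl⟩
  have hfun : (graphChart ψ ∘ (graphChart φ).symm : _ → _) = fun p =>
      ((yPart ψ).comp (graphFrame φ p).1).comp ((xPart ψ).comp (graphFrame φ p).1).inverse :=
    funext fun p => slope_ofFrame ψ _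
  have hg := contDiff_graphFrame φ
  have main : ∀ p, (graphChart φ).symm p ∈ (graphChart ψ).source →
      ContDiffAt ℝ ∞ (graphChart ψ ∘ (graphChart φ).symm) p := by
    intro p hp
    rw [hfun]
    have hp' : graphFrame φ p ∈ posFrames ψ := by
      rw [← preimage_image_posFrames]
      exact hp
    obtain ⟨h, hh⟩ := isInvertible_of_det hp'
    have h1 := (ContinuousLinearMap.compL ℝ _ _ _ (xPart ψ)).contDiff.comp hg
    have h2 := (ContinuousLinearMap.compL ℝ _ _ _ (yPart ψ)).contDiff.comp hg
    refine h2.contDiffAt.clm_comp ?_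
    refine ContDiffAt.comp (g := ContinuousLinearMap.inverse) p ?_ h1.contDiffAt
    show ContDiffAt ℝ ∞ _ ((xPart ψ).comp (graphFrame φ p).1)
    rw [← hh]
    exact contDiffAt_map_inverse h
  intro p hp
  exact (main p hp.1.2).contDiffWithinAt

/-- The canonical identification of the tangent space at `P` with `Lin(P, V/P)`: in linear
coordinates `(x, y)` in which `P` is cut out by `y = 0`, the velocity of the planes `y = p(t) x` at
`p(0) = 0` corresponds to `(x, 0) ↦ (0, p'(0) x) + P`. -/
def tangentToHom [Fact (finrank ℝ V = m + 1 + 1)] (P : OrientedPlane V) :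
    TangentSpace 𝓘(ℝ, (Fin 2 → ℝ) →L[ℝ] (Fin m → ℝ)) P →ₗ[ℝ] (P.plane →ₗ[ℝ] V ⧸ P.plane) where
  toFun (B : (Fin 2 → ℝ) →L[ℝ] (Fin m → ℝ)) :=
    P.plane.mkQ ∘ₗ ((adapted P).symm.toLinearMap ∘ₗ LinearMap.inr ℝ (Fin 2 → ℝ) (Fin m → ℝ) ∘ₗ
      B.toLinearMap ∘ₗ (xPart (adapted P)).toLinearMap ∘ₗ P.plane.subtype)
  map_add' B C := by
    simp only [← LinearMap.comp_add]
    rfl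
  map_smul' c (B : (Fin 2 → ℝ) →L[ℝ] (Fin m → ℝ)) := by
    ext p
    set φ : V ≃L[ℝ] (Fin 2 → ℝ) × (Fin m → ℝ) := adapted P
    have h : ((0 : Fin 2 → ℝ), c • B (xPart φ p)) = c • (0, B (xPart φ p)) := by simp
    show P.plane.mkQ (φ.symm ((0 : Fin 2 → ℝ), c • B (xPart φ p))) = _
    rw [h, map_smul, map_smul]
    rfl

theorem tangentToHom_apply [Fact (finrank ℝ V = m + 1 + 1)] (P : OrientedPlane V)
    (B : (Fin 2 → ℝ) →L[ℝ] (Fin m → ℝ)) (v : P.plane) :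
    tangentToHom P B v = P.plane.mkQ ((adapted (m := m) P).symm (0, B (xPart (adapted (m := m) P) v))) := rfl

/-- `tangentToHom` does not depend on the coordinates: the velocity at `0` of the planes spanned
by frames `f t` is the map `f 0 v ↦ f' v + P`. -/
theorem tangentToHom_velocity [Fact (finrank ℝ V = m + 1 + 1)] (f : ℝ → PlaneFrame V)
    {f' : (Fin 2 → ℝ) →L[ℝ] V} (hf : HasDerivAt (fun t => (f t).1) f' 0) :
    ∃ B : (Fin 2 → ℝ) →L[ℝ] (Fin m → ℝ),
      HasDerivAt (fun t => extChartAt 𝓘(ℝ, (Fin 2 → ℝ) →L[ℝ] (Fin m → ℝ)) (ofFrame (f 0))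
        (ofFrame (f t))) B 0 ∧
      ∀ v, tangentToHom (ofFrame (f 0)) B ⟨(f 0).1 v, v, rfl⟩ =
        (ofFrame (f 0)).plane.mkQ (f' v) := by
  set P := ofFrame (f 0) with hP
  obtain ⟨hs, hk⟩ := (exists_adapted (m := m) P).choose_spec
  set φ := (exists_adapted (m := m) P).choose with hφ
  have hφ' : adapted P = φ := rfl
  have hpos : f 0 ∈ posFrames φ := by
    rw [← preimage_image_posFrames]
    exact hs
  obtain ⟨h, hh⟩ := isInvertible_of_det hpos
  have hx : HasDerivAt (fun t => (xPart φ).comp (f t).1) ((xPart φ).comp f') 0 := by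
    simpa using (hasDerivAt_const (0 : ℝ) (xPart φ)).clm_comp hf
  have hy : HasDerivAt (fun t => (yPart φ).comp (f t).1) ((yPart φ).comp f') 0 := by
    simpa using (hasDerivAt_const (0 : ℝ) (yPart φ)).clm_comp hf
  have hi : DifferentiableAt ℝ (fun t => ((xPart φ).comp (f t).1).inverse) 0 := by
    refine DifferentiableAt.comp (g := ContinuousLinearMap.inverse) (0 : ℝ) ?_ hx.differentiableAt
    rw [← hh]
    exact (contDiffAt_map_inverse (n := 1) h).differentiableAt one_ne_zero
  have hy0 : (yPart φ).comp (f 0).1 = 0 := by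
    ext x : 1
    have : (f 0).1 x ∈ P.plane := ⟨x, rfl⟩
    rw [hk] at this
    exact this
  have hB := hy.clm_comp hi.hasDerivAt
  rw [hy0, ContinuousLinearMap.zero_comp, add_zero, ← hh, ContinuousLinearMap.inverse_equiv] at hB
  refine ⟨((yPart φ).comp f').comp (h.symm : (Fin 2 → ℝ) →L[ℝ] (Fin 2 → ℝ)), ?_, fun v => ?_⟩
  · convert hB using 2 with t
    exact slope_ofFrame φ (f t)
  · have hv : h v = xPart φ ((f 0).1 v) :=
      (congrArg (fun A : (Fin 2 → ℝ) →L[ℝ] (Fin 2 → ℝ) => A v) hh :)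
    have h1 : h.symm (xPart φ ((f 0).1 v)) = v := by
      rw [← hv]
      exact h.symm_apply_apply v
    rw [tangentToHom_apply]
    show P.plane.mkQ (φ.symm (0, yPart φ (f' (h.symm (xPart φ ((f 0).1 v)))))) = _
    rw [h1]
    refine (Submodule.Quotient.eq _).2 ?_
    rw [hk]
    simp

end OrientedPlane

/-! ## The characteristic variety -/

section CharacteristicVariety

variable {P W : Type*} [AddCommGroup P] [Module ℝ P] [AddCommGroup W] [Module ℝ W]

/-- The map `α : P → Lin(U, W)`, `α(p)(u) = u(p)`, of a subspace `U ⊆ Lin(P, W)`. -/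
def evalMap (U : Submodule ℝ (P →ₗ[ℝ] W)) : P →ₗ[ℝ] (U →ₗ[ℝ] W) :=
  LinearMap.flip U.subtype

/-- The complex linear extension of `α` to `P ⊗ ℂ`. -/
def evalMapComplex (U : Submodule ℝ (P →ₗ[ℝ] W)) :
    (ℂ ⊗[ℝ] P) →ₗ[ℂ] (ℂ ⊗[ℝ] U) →ₗ[ℂ] (ℂ ⊗[ℝ] W) :=
  TensorProduct.AlgebraTensorModule.lift
    (LinearMap.toSpanSingleton ℂ _ (LinearMap.baseChangeHom ℝ ℂ U W ∘ₗ evalMap U))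

/-- The polynomial `ξ(z) = det α(z)`, valued in `Lin(Λᵏ U, Λᵏ W) ⊗ ℂ`, where `k` is the common
dimension of `U` and `W`. -/
def charPolynomial (k : ℕ) (U : Submodule ℝ (P →ₗ[ℝ] W)) (z : ℂ ⊗[ℝ] P) :
    (⋀[ℂ]^k (ℂ ⊗[ℝ] U)) →ₗ[ℂ] (⋀[ℂ]^k (ℂ ⊗[ℝ] W)) :=
  exteriorPower.map k (evalMapComplex U z)

/-- The characteristic variety: the zero locus of `ξ` in the projectivization of `P ⊗ ℂ`. -/
def charVariety (k : ℕ) (U : Submodule ℝ (P →ₗ[ℝ] W)) : Set (ℙ ℂ (ℂ ⊗[ℝ] P)) :=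
  {z | charPolynomial k U z.rep = 0}

/-- The real points of the projectivization of `P ⊗ ℂ`. -/
def realPoints (P : Type*) [AddCommGroup P] [Module ℝ P] : Set (ℙ ℂ (ℂ ⊗[ℝ] P)) :=
  {z | ∃ (p : P) (hp : (1 : ℂ) ⊗ₜ[ℝ] p ≠ 0), z = Projectivization.mk ℂ ((1 : ℂ) ⊗ₜ[ℝ] p) hp}

end CharacteristicVariety

/-! ## Elliptic submanifolds and great circle fibrations -/

section GreatCircleFibration

variable (n : ℕ) {X : Type*} [TopologicalSpace X] [ChartedSpace (EuclideanSpace ℝ (Fin (2 * n))) X]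

section Submanifold

variable {V : Type*} [NormedAddCommGroup V] [NormedSpace ℝ V] [Fact (finrank ℝ V = 2 * n + 1 + 1)]

/-- `ι` is an immersion of `X` in the Grassmannian: a smooth map whose differential is injective
at every point. -/
structure IsGrassmannImmersion (ι : X → OrientedPlane V) : Prop where
  contMDiff : ContMDiff (𝓡 (2 * n)) 𝓘(ℝ, (Fin 2 → ℝ) →L[ℝ] (Fin (2 * n) → ℝ)) ∞ ι
  injective_mfderiv : ∀ x : X,
    Injective (mfderiv (𝓡 (2 * n)) 𝓘(ℝ, (Fin 2 → ℝ) →L[ℝ] (Fin (2 * n) → ℝ)) ι x)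

/-- The image `U_P ⊆ Lin(P, V/P)` of the tangent space of `X` at `x`, where `P = ι x`. -/
def tangentImage (ι : X → OrientedPlane V) (x : X) :
    Submodule ℝ ((ι x).plane →ₗ[ℝ] V ⧸ (ι x).plane) :=
  LinearMap.range ((ι x).tangentToHom ∘ₗ
    (mfderiv (𝓡 (2 * n)) 𝓘(ℝ, (Fin 2 → ℝ) →L[ℝ] (Fin (2 * n) → ℝ)) ι x).toLinearMap)

/-- `ι` is elliptic: at every point, the characteristic variety has no real points. -/
def IsElliptic (ι : X → OrientedPlane V) : Prop :=
  ∀ x : X, charVariety (2 * n) (tangentImage n ι x) ∩ realPoints (ι x).plane = ∅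

end Submanifold

variable {V : Type*} [NormedAddCommGroup V] [InnerProductSpace ℝ V]

/-- The great circle of the unit sphere of `V` lying in the plane `P`. -/
def greatCircle (P : OrientedPlane V) : Set (sphere (0 : V) 1) :=
  {v | (v : V) ∈ P.plane}

variable [Fact (finrank ℝ V = 2 * n + 1 + 1)]

/-- `π : S²ⁿ⁺¹ → X` is a smooth great circle fibration: a smooth fibre bundle with fibre the circle,
all of whose fibres are great circles. -/
structure IsGreatCircleFibration (π : sphere (0 : V) 1 → X) : Prop where
  locallyTrivial : ∀ x : X, ∃ e : Bundle.Trivialization Circle π, x ∈ e.baseSet ∧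
    ContMDiffOn (𝓡 (2 * n + 1)) ((𝓡 (2 * n)).prod (𝓡 1)) ∞ e e.source ∧
    ContMDiffOn ((𝓡 (2 * n)).prod (𝓡 1)) (𝓡 (2 * n + 1)) ∞ e.toOpenPartialHomeomorph.symm e.target
  fibre : ∀ x : X, ∃ P : OrientedPlane V, π ⁻¹' {x} = greatCircle P

/-- `X`, mapped to the Grassmannian by `ι`, is the base of a great circle fibration: there is a
great circle fibration of the sphere over `X` whose fibre over each `x` is the great circle of the
oriented plane `ι x`. -/
def IsBaseOfGreatCircleFibration (ι : X → OrientedPlane V) : Prop :=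
  ∃ π : sphere (0 : V) 1 → X, IsGreatCircleFibration n π ∧ ∀ x : X, π ⁻¹' {x} = greatCircle (ι x)

end GreatCircleFibration

end

/-! ## Determinants as maps of top exterior powers -/

section LinearAlgebra

/-! In linear coordinates `(x, y)` in which `ι x₀` is `y = 0`, the nearby planes are graphs `y =
S(z) x`, where `z` is a chart of `X`. A real point of the characteristic variety is a vector `a ≠ 0`
with `S'(ξ) a = 0` for some tangent vector `ξ ≠ 0` (`isElliptic_iff`). Ellipticity therefore says
that `y - S(z) x = 0` can be solved smoothly and uniquely for `z` near any nonzero vector of the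
plane (`exists_local_section`).

Given a fibration `π`, `X` is a continuous image of the sphere, hence compact and connected.
Moreover `π` recovers `z` from the direction of `(a, S(z) a)`, so the derivative `ξ ↦ (0, S'(ξ) a)`
is injective (`isElliptic_of_fibration`).

Conversely, let `E` be the set of pairs `(x, v)` with `v` a unit vector of `ι x`. Ellipticity makes
`E → S²ⁿ⁺¹` a local homeomorphism; `E` is compact, so this is a covering, onto because the sphere is
connected. It has a single sheet (`existsUnique_mem_plane`): remove from `V` the ray opposite to a
vector `N`. The remaining set is contractible, so the covering yields a continuous `σ` on it with `v
∈ ι (σ v)`. Each plane meets this set in a connected set, on which `σ` is constant as soon as it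
takes the value of that plane once. The range of `σ` is clopen, hence all of `X`, so every plane
through `N` is `ι (σ N)`. The resulting map `π` agrees locally with the smooth solutions, and graph
coordinates trivialize it (`exists_trivialization`). -/

/-- The top exterior power of `M` is a line, which an injective map carries injectively. If `A` is
not injective it is not onto either, so the images of `k` vectors never form a basis and their wedge
vanishes. -/
theorem exteriorPower_map_eq_zero_iff {K M N : Type*} [Field K] [AddCommGroup M] [Module K M]
    [AddCommGroup N] [Module K N] [FiniteDimensional K M] [FiniteDimensional K N] {k : ℕ}
    (hM : finrank K M = k) (hN : finrank K N = k) (A : M →ₗ[K] N) :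
    exteriorPower.map k A = 0 ↔ ¬ Injective A := by
  constructor
  · intro h hA
    have hinj := exteriorPower.map_injective_field (n := k) hA
    have hrank : finrank K (⋀[K]^k M) = 1 := by
      rw [exteriorPower.finrank_eq, hM, Nat.choose_self]
    have : Nontrivial (⋀[K]^k M) := Module.nontrivial_of_finrank_pos (R := K) (by omega)
    obtain ⟨a, b, hab⟩ := exists_pair_ne (⋀[K]^k M)
    exact hab (hinj (by simp [h]))
  · intro hA
    have hs : ¬ Surjective A := fun h =>
      hA ((LinearMap.injective_iff_surjective_of_finrank_eq_finrank (hM.trans hN.symm)).2 h)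
    apply exteriorPower.linearMap_ext
    ext m : 1
    show exteriorPower.map k A (exteriorPower.ιMulti K k m) = 0
    rw [exteriorPower.map_apply_ιMulti]
    apply AlternatingMap.map_linearDependent
    intro hli
    have hspan : Submodule.span K (range (A ∘ m)) = ⊤ :=
      hli.span_eq_top_of_card_eq_finrank' (by simp [hN])
    refine hs (LinearMap.range_eq_top.1 (top_le_iff.1 ?_))
    rw [← hspan, Submodule.span_le]
    rintro _ ⟨i, rfl⟩
    exact ⟨m i, rfl⟩

variable {P W : Type*} [AddCommGroup P] [Module ℝ P] [AddCommGroup W] [Module ℝ W]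

theorem evalMapComplex_one_tmul (U : Submodule ℝ (P →ₗ[ℝ] W)) (p : P) :
    evalMapComplex U ((1 : ℂ) ⊗ₜ[ℝ] p) = (evalMap U p).baseChange ℂ := by
  simp [evalMapComplex]

/-- At `1 ⊗ p` the complexified map is the base change of `evalMap U p`, and `ℂ` is faithfully flat
over `ℝ`, so injectivity passes in both directions. -/
theorem charVariety_inter_realPoints_eq_empty_iff [FiniteDimensional ℝ P] [FiniteDimensional ℝ W]
    {k : ℕ} {U : Submodule ℝ (P →ₗ[ℝ] W)} (hU : finrank ℝ U = k) (hW : finrank ℝ W = k) :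
    charVariety k U ∩ realPoints P = ∅ ↔ ∀ p : P, p ≠ 0 → Injective (evalMap U p) := by
  have key : ∀ (p : P) (hp : (1 : ℂ) ⊗ₜ[ℝ] p ≠ 0),
      Projectivization.mk ℂ ((1 : ℂ) ⊗ₜ[ℝ] p) hp ∈ charVariety k U ↔
        ¬ Injective (evalMap U p) := by
    intro p hp
    -- The chosen representative is only a unit multiple of `1 ⊗ p`, which does not affect
    -- injectivity.
    obtain ⟨a, ha⟩ := Projectivization.exists_smul_eq_mk_rep ℂ ((1 : ℂ) ⊗ₜ[ℝ] p) hp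
    have hinj : Injective (evalMapComplex U ((1 : ℂ) ⊗ₜ[ℝ] p)) ↔ Injective (evalMap U p) := by
      rw [evalMapComplex_one_tmul, LinearMap.baseChange_eq_ltensor]
      exact Module.FaithfullyFlat.lTensor_injective_iff_injective ℝ ℂ (evalMap U p)
    have hsmul : Injective (evalMapComplex U (a • (1 : ℂ) ⊗ₜ[ℝ] p)) ↔
        Injective (evalMapComplex U ((1 : ℂ) ⊗ₜ[ℝ] p)) := by
      have : ⇑(evalMapComplex U (a • (1 : ℂ) ⊗ₜ[ℝ] p)) =
          (fun y => a • y) ∘ evalMapComplex U ((1 : ℂ) ⊗ₜ[ℝ] p) := by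
        have h : evalMapComplex U (a • (1 : ℂ) ⊗ₜ[ℝ] p) =
            (a : ℂ) • evalMapComplex U ((1 : ℂ) ⊗ₜ[ℝ] p) := map_smul (evalMapComplex U) (a : ℂ) _
        rw [h]
        rfl
      rw [this]
      exact (MulAction.injective a).of_comp_iff _
    show exteriorPower.map k (evalMapComplex U _) = 0 ↔ _
    rw [exteriorPower_map_eq_zero_iff (by rw [Module.finrank_baseChange, hU])
      (by rw [Module.finrank_baseChange, hW]), ← ha, hsmul, hinj]
  constructor
  · intro h p hp
    by_contra hc
    have hp' : (1 : ℂ) ⊗ₜ[ℝ] p ≠ 0 := fun h0 =>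
      hp ((Module.FaithfullyFlat.one_tmul_eq_zero_iff ℝ P p).1 h0)
    have : Projectivization.mk ℂ ((1 : ℂ) ⊗ₜ[ℝ] p) hp' ∈ charVariety k U ∩ realPoints P :=
      ⟨(key p hp').2 hc, p, hp', rfl⟩
    rw [h] at this
    exact this
  · intro h
    rw [eq_empty_iff_forall_notMem]
    rintro _ ⟨hz, p, hp, rfl⟩
    refine (key p hp).1 hz (h p ?_)
    rintro rfl
    simp at hp

end LinearAlgebra

/-! ## Ellipticity in graph coordinates -/

namespace OrientedPlane

variable {V : Type*} [NormedAddCommGroup V] [NormedSpace ℝ V] {m : ℕ}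

theorem mem_plane_iff {φ : V ≃L[ℝ] (Fin 2 → ℝ) × (Fin m → ℝ)} {P : OrientedPlane V}
    (hP : P ∈ (graphChart φ).source) (v : V) :
    v ∈ P.plane ↔ yPart φ v = slope φ P (xPart φ v) := by
  have hP' : ofFrame (graphFrame φ (slope φ P)) = P := (graphChart φ).left_inv hP
  have hv : v ∈ (ofFrame (graphFrame φ (slope φ P))).plane ↔
      ∃ a, φ.symm (a, slope φ P a) = v := Iff.rfl
  rw [hP'] at hv
  rw [hv]
  constructor
  · rintro ⟨a, rfl⟩
    simp
  · intro h
    refine ⟨xPart φ v, φ.injective ?_⟩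
    rw [← h]
    simp

variable [Fact (finrank ℝ V = m + 1 + 1)]

theorem mem_source_adapted (P : OrientedPlane V) : P ∈ (graphChart (adapted (m := m) P)).source :=
  (exists_adapted P).choose_spec.1

theorem mem_plane_iff_yPart_adapted (P : OrientedPlane V) (v : V) :
    v ∈ P.plane ↔ yPart (adapted (m := m) P) v = 0 := by
  conv_lhs => rw [(exists_adapted (m := m) P).choose_spec.2]
  exact Iff.rfl

theorem symm_adapted_mem (P : OrientedPlane V) (a : Fin 2 → ℝ) :
    (adapted (m := m) P).symm (a, 0) ∈ P.plane := by
  rw [mem_plane_iff_yPart_adapted (m := m)]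
  simp

theorem symm_adapted_xPart {P : OrientedPlane V} {v : V} (hv : v ∈ P.plane) :
    (adapted (m := m) P).symm (xPart (adapted (m := m) P) v, 0) = v := by
  rw [mem_plane_iff_yPart_adapted (m := m), yPart_apply] at hv
  apply (adapted (m := m) P).injective
  rw [ContinuousLinearEquiv.apply_symm_apply, ← hv]
  rfl

theorem tangentToHom_apply_eq_zero_iff (P : OrientedPlane V)
    (B : (Fin 2 → ℝ) →L[ℝ] (Fin m → ℝ)) (v : P.plane) :
    tangentToHom P B v = 0 ↔ B (xPart (adapted (m := m) P) v) = 0 := by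
  rw [tangentToHom_apply, Submodule.mkQ_apply, Submodule.Quotient.mk_eq_zero,
    mem_plane_iff_yPart_adapted (m := m)]
  simp

theorem tangentToHom_injective (P : OrientedPlane V) : Injective (tangentToHom (m := m) P) := by
  rw [injective_iff_map_eq_zero]
  intro (B : (Fin 2 → ℝ) →L[ℝ] (Fin m → ℝ)) hB
  refine ContinuousLinearMap.ext fun a => ?_
  have h := (tangentToHom_apply_eq_zero_iff P B ⟨_, symm_adapted_mem (m := m) P a⟩).1
    (by rw [hB]; rfl)
  rwa [xPart_apply, ContinuousLinearEquiv.apply_symm_apply] at h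

theorem finrank_quotient_plane (P : OrientedPlane V) : finrank ℝ (V ⧸ P.plane) = m := by
  have hV : finrank ℝ V = m + 1 + 1 := Fact.out
  have : FiniteDimensional ℝ V := Module.finite_of_finrank_pos (by omega)
  have := P.plane.finrank_quotient_add_finrank
  rw [P.finrank_plane] at this
  omega

end OrientedPlane

section Elliptic

open OrientedPlane

variable (n : ℕ) {X : Type*} [TopologicalSpace X] [ChartedSpace (EuclideanSpace ℝ (Fin (2 * n))) X]
  {V : Type*} [NormedAddCommGroup V] [NormedSpace ℝ V] [Fact (finrank ℝ V = 2 * n + 1 + 1)]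

/-- The differential of `ι` at `x`, read in the preferred charts at `x` and `ι x`. -/
noncomputable def slopeDeriv (ι : X → OrientedPlane V) (x : X) :
    EuclideanSpace ℝ (Fin (2 * n)) →L[ℝ] (Fin 2 → ℝ) →L[ℝ] (Fin (2 * n) → ℝ) :=
  mfderiv (𝓡 (2 * n)) 𝓘(ℝ, (Fin 2 → ℝ) →L[ℝ] (Fin (2 * n) → ℝ)) ι x

/-- Since `ι` is an immersion, `ξ ↦ T ξ` identifies the tangent space with `tangentImage`, which
thus has the dimension of `V/P`. The `x`-coordinate identifies the plane with `ℝ²`, so nonzero `p`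
correspond to nonzero `a`. -/
theorem isElliptic_iff {ι : X → OrientedPlane V} (hι : IsGrassmannImmersion n ι) :
    IsElliptic n ι ↔ ∀ (x : X) (a : Fin 2 → ℝ), a ≠ 0 →
      ∀ ξ : EuclideanSpace ℝ (Fin (2 * n)), slopeDeriv n ι x ξ a = 0 → ξ = 0 := by
  have hV : finrank ℝ V = 2 * n + 1 + 1 := Fact.out
  have : FiniteDimensional ℝ V := Module.finite_of_finrank_pos (by omega)
  refine forall_congr' fun x => ?_
  let T : EuclideanSpace ℝ (Fin (2 * n)) →ₗ[ℝ] (ι x).plane →ₗ[ℝ] V ⧸ (ι x).plane :=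
    (ι x).tangentToHom ∘ₗ
    (mfderiv (𝓡 (2 * n)) 𝓘(ℝ, (Fin 2 → ℝ) →L[ℝ] (Fin (2 * n) → ℝ)) ι x).toLinearMap
  have hT : Injective T := (tangentToHom_injective (ι x)).comp (hι.injective_mfderiv x)
  have hU : finrank ℝ (tangentImage n ι x) = 2 * n :=
    (LinearMap.finrank_range_of_inj hT).trans (by simp)
  have hT0 : ∀ ξ p, T ξ p = 0 ↔
      slopeDeriv n ι x ξ (xPart (adapted (m := 2 * n) (ι x)) p) = 0 := fun ξ p =>
    tangentToHom_apply_eq_zero_iff (ι x) (slopeDeriv n ι x ξ) p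
  rw [charVariety_inter_realPoints_eq_empty_iff hU (finrank_quotient_plane (ι x))]
  constructor
  · intro h a ha ξ hξ
    set p : (ι x).plane := ⟨_, symm_adapted_mem (m := 2 * n) (ι x) a⟩ with hp
    have hx : xPart (adapted (m := 2 * n) (ι x)) p = a := by simp [hp]
    have hp0 : p ≠ 0 := by
      intro h0
      rw [h0] at hx
      exact ha (by rw [← hx]; simp)
    have h1 : evalMap (tangentImage n ι x) p ⟨T ξ, ξ, rfl⟩ = 0 := by
      show T ξ p = 0
      rw [hT0, hx, hξ]
    have h2 := (injective_iff_map_eq_zero _).1 (h p hp0) _ h1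
    exact (injective_iff_map_eq_zero _).1 hT ξ (congrArg Subtype.val h2)
  · intro h p hp
    rw [injective_iff_map_eq_zero]
    rintro ⟨_, ξ, rfl⟩ hξ
    have h0 : xPart (adapted (m := 2 * n) (ι x)) p ≠ 0 := by
      intro h0
      have := symm_adapted_xPart (m := 2 * n) p.2
      rw [h0, ← Prod.zero_eq_mk, map_zero] at this
      exact hp (Subtype.ext this.symm)
    have : ξ = 0 := h _ h0 ξ ((hT0 ξ p).1 hξ)
    subst this
    exact Subtype.ext (map_zero T)

end Elliptic

/-! ## Local solutions of `v ∈ ι x` -/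

section LocalSection

open OrientedPlane Filter

variable (n : ℕ) {X : Type*} [TopologicalSpace X] [ChartedSpace (EuclideanSpace ℝ (Fin (2 * n))) X]
  {V : Type*} [NormedAddCommGroup V] [NormedSpace ℝ V] [Fact (finrank ℝ V = 2 * n + 1 + 1)]

/-- The slope of `ι` in graph coordinates at `x₀`, as a function of the coordinates of `X`. -/
noncomputable def chartSlope (ι : X → OrientedPlane V) (x₀ : X) (z : EuclideanSpace ℝ (Fin (2 * n))) :
    (Fin 2 → ℝ) →L[ℝ] (Fin (2 * n) → ℝ) :=
  slope (adapted (m := 2 * n) (ι x₀)) (ι ((extChartAt (𝓡 (2 * n)) x₀).symm z))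

theorem contDiffAt_chartSlope {ι : X → OrientedPlane V} (hι : IsGrassmannImmersion n ι) (x₀ : X) :
    ContDiffAt ℝ ∞ (chartSlope n ι x₀) (extChartAt (𝓡 (2 * n)) x₀ x₀) := by
  have h := (contMDiffAt_iff.1 (hι.contMDiff.contMDiffAt (x := x₀))).2
  rw [modelWithCornersSelf_coe, range_id, contDiffWithinAt_univ] at h
  exact h

/-- `mfderiv` is the derivative in the preferred charts, and the preferred chart at `ι x₀` is
`slope` in the adapted coordinates. -/
theorem fderiv_chartSlope {ι : X → OrientedPlane V} (hι : IsGrassmannImmersion n ι) (x₀ : X) :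
    fderiv ℝ (chartSlope n ι x₀) (extChartAt (𝓡 (2 * n)) x₀ x₀) = slopeDeriv n ι x₀ := by
  have h := (hι.contMDiff.contMDiffAt (x := x₀)).mdifferentiableAt (by simp)
  have h2 := h.mfderiv
  rw [modelWithCornersSelf_coe, range_id, fderivWithin_univ] at h2
  exact h2.symm

theorem isOpen_preimage_source {ι : X → OrientedPlane V} (hι : IsGrassmannImmersion n ι) (x₀ : X) :
    IsOpen (ι ⁻¹' (graphChart (adapted (m := 2 * n) (ι x₀))).source) :=
  (graphChart (adapted (m := 2 * n) (ι x₀))).open_source.preimage hι.contMDiff.continuous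

/-- The implicit function theorem for `y - S(z) x = 0`. Its `z`-derivative `ξ ↦ -S'(ξ) x` is
injective by ellipticity, because `x ≠ 0`, and both sides have dimension `2 * n`. -/
theorem exists_local_section {ι : X → OrientedPlane V} (hι : IsGrassmannImmersion n ι)
    [IsManifold (𝓡 (2 * n)) ∞ X]
    (hell : IsElliptic n ι) {x₀ : X} {v₀ : V} (h0 : v₀ ≠ 0) (hv₀ : v₀ ∈ (ι x₀).plane) :
    ∃ σ : V → X, ContMDiffAt 𝓘(ℝ, V) (𝓡 (2 * n)) ∞ σ v₀ ∧ σ v₀ = x₀ ∧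
      ∀ᶠ q : X × V in 𝓝 (x₀, v₀), q.2 ∈ (ι q.1).plane ↔ σ q.2 = q.1 := by
  have hV : finrank ℝ V = 2 * n + 1 + 1 := Fact.out
  have : FiniteDimensional ℝ V := Module.finite_of_finrank_pos (by omega)
  have : CompleteSpace V := FiniteDimensional.complete ℝ V
  set φ := adapted (m := 2 * n) (ι x₀)
  set c := extChartAt (𝓡 (2 * n)) x₀ with hc
  set S := chartSlope n ι x₀
  have hS : ContDiffAt ℝ ∞ S (c x₀) := contDiffAt_chartSlope n hι x₀
  let f : V × EuclideanSpace ℝ (Fin (2 * n)) → (Fin (2 * n) → ℝ) :=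
    fun u => yPart φ u.1 - S u.2 (xPart φ u.1)
  have hS2 : ContDiffAt ℝ ∞ (fun u : V × EuclideanSpace ℝ (Fin (2 * n)) => S u.2) (v₀, c x₀) :=
    ContDiffAt.comp (g := S) (v₀, c x₀) hS contDiffAt_snd
  have hf : ContDiffAt ℝ ∞ f (v₀, c x₀) :=
    ((yPart φ).contDiff.contDiffAt.comp _ contDiffAt_fst).sub
      (hS2.clm_apply ((xPart φ).contDiff.contDiffAt.comp _ contDiffAt_fst))
  have hx0 : xPart φ v₀ ≠ 0 := by
    intro h
    have := symm_adapted_xPart (m := 2 * n) hv₀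
    change φ.symm (xPart φ v₀, 0) = v₀ at this
    rw [h, ← Prod.zero_eq_mk, map_zero] at this
    exact h0 this.symm
  have hfd : ∀ ξ, (fderiv ℝ f (v₀, c x₀) ∘L .inr ℝ V (EuclideanSpace ℝ (Fin (2 * n)))) ξ =
      -(slopeDeriv n ι x₀ ξ (xPart φ v₀)) := by
    intro ξ
    have h1 : HasFDerivAt f (fderiv ℝ f (v₀, c x₀)) (v₀, c x₀) :=
      (hf.differentiableAt (by simp)).hasFDerivAt
    have h2 : HasFDerivAt (fun z => f (v₀, z))
        (fderiv ℝ f (v₀, c x₀) ∘L .inr ℝ V (EuclideanSpace ℝ (Fin (2 * n)))) (c x₀) :=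
      h1.comp (c x₀) (hasFDerivAt_prodMk_right v₀ (c x₀))
    have h3 : HasFDerivAt S (slopeDeriv n ι x₀) (c x₀) := by
      rw [← fderiv_chartSlope n hι x₀]
      exact (hS.differentiableAt (by simp)).hasFDerivAt
    have h4 := (h3.clm_apply (hasFDerivAt_const (xPart φ v₀) (c x₀))).const_sub (yPart φ v₀)
    rw [h2.unique h4]
    simp
  have hinv : (fderiv ℝ f (v₀, c x₀) ∘L
      .inr ℝ V (EuclideanSpace ℝ (Fin (2 * n)))).IsInvertible := by
    set A := fderiv ℝ f (v₀, c x₀) ∘L .inr ℝ V (EuclideanSpace ℝ (Fin (2 * n)))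
    have hA : Injective (A : EuclideanSpace ℝ (Fin (2 * n)) →ₗ[ℝ] (Fin (2 * n) → ℝ)) := by
      rw [injective_iff_map_eq_zero]
      intro ξ hξ
      have : A ξ = 0 := hξ
      rw [hfd, neg_eq_zero] at this
      exact (isElliptic_iff n hι).1 hell x₀ _ hx0 ξ this
    refine ⟨(LinearEquiv.ofInjectiveOfFinrankEq _ hA (by simp)).toContinuousLinearEquiv, ?_⟩
    ext ξ : 1
    rfl
  have hfu : f (v₀, c x₀) = 0 := by
    have h := (mem_plane_iff (mem_source_adapted (m := 2 * n) (ι x₀)) v₀).1 hv₀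
    have hcx : c.symm (c x₀) = x₀ := extChartAt_to_inv x₀
    show yPart φ v₀ - slope φ (ι (c.symm (c x₀))) (xPart φ v₀) = 0
    rw [hcx, sub_eq_zero]
    exact h
  have htop : (∞ : WithTop ℕ∞) ≠ 0 := by simp
  set ψ := hf.implicitFunction htop hinv with hψ
  have hψ0 : ψ v₀ = c x₀ := hf.implicitFunction_apply_self htop hinv
  have hψs : ContDiffAt ℝ ∞ ψ v₀ := hf.contDiffAt_implicitFunction htop hinv
  have hev := hf.eventually_apply_eq_iff_implicitFunction htop hinv
  rw [hfu] at hev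
  refine ⟨c.symm ∘ ψ, ?_, ?_, ?_⟩
  · refine ContMDiffAt.comp (I' := 𝓘(ℝ, EuclideanSpace ℝ (Fin (2 * n)))) v₀ ?_ hψs.contMDiffAt
    rw [hψ0]
    exact (contMDiffOn_extChartAt_symm x₀).contMDiffAt (extChartAt_target_mem_nhds x₀)
  · show c.symm (ψ v₀) = x₀
    rw [hψ0]
    exact extChartAt_to_inv x₀
  · have hcont : ContinuousAt (fun q : X × V => (q.2, c q.1)) (x₀, v₀) :=
      continuousAt_snd.prodMk (ContinuousAt.comp (f := Prod.fst) (g := c) (x := (x₀, v₀))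
        (continuousAt_extChartAt x₀) continuousAt_fst)
    -- Needed to pass back from `c.symm (ψ v) = x` to `ψ v = c x`: the inverse chart is injective
    -- only on the target.
    have hψt : ∀ᶠ q : X × V in 𝓝 (x₀, v₀), ψ q.2 ∈ c.target := by
      refine (ContinuousAt.comp (f := Prod.snd) (g := ψ) (x := (x₀, v₀)) hψs.continuousAt
        continuousAt_snd) ?_
      show c.target ∈ 𝓝 (ψ v₀)
      rw [hψ0]
      exact extChartAt_target_mem_nhds x₀
    have hsrc : ∀ᶠ q : X × V in 𝓝 (x₀, v₀), q.1 ∈ c.source :=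
      continuousAt_fst (extChartAt_source_mem_nhds x₀)
    have hgr : ∀ᶠ q : X × V in 𝓝 (x₀, v₀), ι q.1 ∈ (graphChart φ).source :=
      continuousAt_fst ((isOpen_preimage_source n hι x₀).mem_nhds
        (show x₀ ∈ _ from mem_source_adapted (m := 2 * n) (ι x₀)))
    filter_upwards [hcont hev, hψt, hsrc, hgr] with q h1 h2 h3 h4
    rw [mem_plane_iff h4]
    have h5 : f (q.2, c q.1) = 0 ↔ ψ q.2 = c q.1 := h1
    have h6 : f (q.2, c q.1) = yPart φ q.2 - slope φ (ι q.1) (xPart φ q.2) := by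
      show yPart φ q.2 - slope φ (ι (c.symm (c q.1))) (xPart φ q.2) = _
      rw [c.left_inv h3]
    rw [← sub_eq_zero, ← h6, h5]
    show _ ↔ c.symm (ψ q.2) = q.1
    constructor
    · intro h
      rw [h, c.left_inv h3]
    · intro h
      rw [← h, c.right_inv h2]

end LocalSection

/-! ## The incidence correspondence -/

section Incidence

open OrientedPlane Filter

/-! ### Local frames of the family of planes -/

section LocalFrame

variable (n : ℕ) {X : Type*} {V : Type*} [NormedAddCommGroup V] [NormedSpace ℝ V]
  [Fact (finrank ℝ V = 2 * n + 1 + 1)]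

/-- The local section through `(a, 0)` of the family of planes `ι x` near `x₀`. -/
noncomputable def localFrame (ι : X → OrientedPlane V) (x₀ : X) (x : X) (a : Fin 2 → ℝ) : V :=
  (graphFrame (adapted (m := 2 * n) (ι x₀)) (slope (adapted (m := 2 * n) (ι x₀)) (ι x))).1 a

theorem localFrame_apply (ι : X → OrientedPlane V) (x₀ x : X) (a : Fin 2 → ℝ) :
    localFrame n ι x₀ x a = (adapted (m := 2 * n) (ι x₀)).symm
      (a, slope (adapted (m := 2 * n) (ι x₀)) (ι x) a) := rfl

theorem xPart_localFrame (ι : X → OrientedPlane V) (x₀ x : X) (a : Fin 2 → ℝ) :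
    xPart (adapted (m := 2 * n) (ι x₀)) (localFrame n ι x₀ x a) = a := by
  rw [localFrame_apply]
  simp

theorem localFrame_mem (ι : X → OrientedPlane V) {x₀ x : X}
    (hx : ι x ∈ (graphChart (adapted (m := 2 * n) (ι x₀))).source) (a : Fin 2 → ℝ) :
    localFrame n ι x₀ x a ∈ (ι x).plane := by
  rw [mem_plane_iff hx, localFrame_apply]
  simp

theorem localFrame_xPart (ι : X → OrientedPlane V) {x₀ x : X} {v : V}
    (hx : ι x ∈ (graphChart (adapted (m := 2 * n) (ι x₀))).source) (hv : v ∈ (ι x).plane) :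
    localFrame n ι x₀ x (xPart (adapted (m := 2 * n) (ι x₀)) v) = v := by
  rw [mem_plane_iff hx] at hv
  apply (adapted (m := 2 * n) (ι x₀)).injective
  rw [localFrame_apply, ContinuousLinearEquiv.apply_symm_apply, ← hv]
  rfl

theorem xPart_ne_zero {ι : X → OrientedPlane V} {x₀ x : X} {v : V}
    (hx : ι x ∈ (graphChart (adapted (m := 2 * n) (ι x₀))).source) (hv : v ∈ (ι x).plane)
    (h0 : v ≠ 0) : xPart (adapted (m := 2 * n) (ι x₀)) v ≠ 0 := by
  intro h
  have := localFrame_xPart n ι hx hv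
  rw [h] at this
  exact h0 (this.symm.trans (map_zero (graphFrame _ _).1))

end LocalFrame

variable (n : ℕ) {X : Type*} [TopologicalSpace X] [ChartedSpace (EuclideanSpace ℝ (Fin (2 * n))) X]

section Normed

variable {V : Type*} [NormedAddCommGroup V] [NormedSpace ℝ V] [Fact (finrank ℝ V = 2 * n + 1 + 1)]

theorem contMDiffOn_slope {ι : X → OrientedPlane V} (hι : IsGrassmannImmersion n ι) (x₀ : X) :
    ContMDiffOn (𝓡 (2 * n)) 𝓘(ℝ, (Fin 2 → ℝ) →L[ℝ] (Fin (2 * n) → ℝ)) ∞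
      (fun x => slope (adapted (m := 2 * n) (ι x₀)) (ι x))
      (ι ⁻¹' (graphChart (adapted (m := 2 * n) (ι x₀))).source) := by
  have h := contMDiffOn_extChartAt (I := 𝓘(ℝ, (Fin 2 → ℝ) →L[ℝ] (Fin (2 * n) → ℝ)))
    (n := ∞) (x := ι x₀)
  exact h.comp hι.contMDiff.contMDiffOn (subset_refl _)

theorem preimage_source_mem_nhds {ι : X → OrientedPlane V} (hι : IsGrassmannImmersion n ι)
    (x₀ : X) : ι ⁻¹' (graphChart (adapted (m := 2 * n) (ι x₀))).source ∈ 𝓝 x₀ :=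
  (isOpen_preimage_source n hι x₀).mem_nhds (mem_source_adapted (m := 2 * n) (ι x₀))

theorem contMDiffOn_localFrame {ι : X → OrientedPlane V} (hι : IsGrassmannImmersion n ι) (x₀ : X) :
    ContMDiffOn ((𝓡 (2 * n)).prod 𝓘(ℝ, Fin 2 → ℝ)) 𝓘(ℝ, V) ∞
      (fun q : X × (Fin 2 → ℝ) => localFrame n ι x₀ q.1 q.2)
      ((ι ⁻¹' (graphChart (adapted (m := 2 * n) (ι x₀))).source) ×ˢ univ) := by
  have h1 : ContMDiffOn ((𝓡 (2 * n)).prod 𝓘(ℝ, Fin 2 → ℝ)) 𝓘(ℝ, (Fin 2 → ℝ) →L[ℝ] V) ∞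
      (fun q : X × (Fin 2 → ℝ) => (graphFrame (adapted (m := 2 * n) (ι x₀))
        (slope (adapted (m := 2 * n) (ι x₀)) (ι q.1))).1)
      ((ι ⁻¹' (graphChart (adapted (m := 2 * n) (ι x₀))).source) ×ˢ univ) :=
    (contDiff_graphFrame _).contMDiff.comp_contMDiffOn
      ((contMDiffOn_slope n hι x₀).comp contMDiffOn_fst fun q hq => hq.1)
  exact h1.clm_apply contMDiffOn_snd

theorem contMDiffAt_localFrame {ι : X → OrientedPlane V} (hι : IsGrassmannImmersion n ι) (x₀ : X)
    (a : Fin 2 → ℝ) : ContMDiffAt (𝓡 (2 * n)) 𝓘(ℝ, V) ∞ (fun x => localFrame n ι x₀ x a) x₀ :=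
  ((contMDiffOn_localFrame n hι x₀).comp
    (contMDiffOn_id.prodMk contMDiffOn_const) fun _ hx => ⟨hx, mem_univ _⟩).contMDiffAt
    (preimage_source_mem_nhds n hι x₀)

/-- Moves a vector along with its plane: keep its `x`-coordinate fixed and let the graph vary. -/
theorem exists_local_frame_through {ι : X → OrientedPlane V} (hι : IsGrassmannImmersion n ι)
    {x₀ : X} {v₀ : V} (hv₀ : v₀ ∈ (ι x₀).plane) :
    ∃ g : X → V, ContinuousAt g x₀ ∧ g x₀ = v₀ ∧ ∀ᶠ x in 𝓝 x₀, g x ∈ (ι x).plane :=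
  ⟨_, (contMDiffAt_localFrame n hι x₀ _).continuousAt,
    localFrame_xPart n ι (mem_source_adapted (m := 2 * n) (ι x₀)) hv₀,
    eventually_of_mem (preimage_source_mem_nhds n hι x₀) fun _ hx => localFrame_mem n ι hx _⟩

theorem isClosed_incidence {ι : X → OrientedPlane V} (hι : IsGrassmannImmersion n ι) :
    IsClosed {q : X × V | q.2 ∈ (ι q.1).plane} := by
  rw [← isOpen_compl_iff, isOpen_iff_mem_nhds]
  rintro ⟨x₀, v₀⟩ hq
  set φ := adapted (m := 2 * n) (ι x₀)
  have hs : ContinuousAt (fun q : X × V => slope φ (ι q.1)) (x₀, v₀) :=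
    ContinuousAt.comp (f := Prod.fst) (g := fun x => slope φ (ι x)) (x := (x₀, v₀))
      ((contMDiffOn_slope n hι x₀).continuousOn.continuousAt
        (preimage_source_mem_nhds n hι x₀)) continuousAt_fst
  have hg : ContinuousAt (fun q : X × V => yPart φ q.2 - slope φ (ι q.1) (xPart φ q.2))
      (x₀, v₀) :=
    ((yPart φ).continuous.continuousAt.comp continuousAt_snd).sub
      (hs.clm_apply ((xPart φ).continuous.continuousAt.comp continuousAt_snd))
  have hne : yPart φ v₀ - slope φ (ι x₀) (xPart φ v₀) ≠ 0 := fun h =>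
    hq ((mem_plane_iff (mem_source_adapted (m := 2 * n) (ι x₀)) v₀).2 (sub_eq_zero.1 h))
  filter_upwards [hg.eventually_ne hne, continuousAt_fst (preimage_source_mem_nhds n hι x₀)]
    with q h1 h2 h3
  exact h1 (sub_eq_zero.2 ((mem_plane_iff h2 _).1 h3))

/-- Near `(x₀, v₀)` both `x` and `x'` must equal the local solution `σ v`. -/
theorem exists_nhds_unique [IsManifold (𝓡 (2 * n)) ∞ X] {ι : X → OrientedPlane V}
    (hι : IsGrassmannImmersion n ι) (hell : IsElliptic n ι) {x₀ : X} {v₀ : V} (h0 : v₀ ≠ 0)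
    (hv₀ : v₀ ∈ (ι x₀).plane) :
    ∃ A ∈ 𝓝 x₀, ∃ B ∈ 𝓝 v₀, ∀ v ∈ B, ∀ x ∈ A, ∀ x' ∈ A,
      v ∈ (ι x).plane → v ∈ (ι x').plane → x = x' := by
  obtain ⟨σ, -, -, h⟩ := exists_local_section n hι hell h0 hv₀
  rw [nhds_prod_eq, eventually_prod_iff] at h
  obtain ⟨p, hp, q, hq, h⟩ := h
  exact ⟨_, hp, _, hq, fun v hv x hx x' hx' h1 h2 =>
    ((h hx hv).1 h1).symm.trans ((h hx' hv).1 h2)⟩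

end Normed

theorem one_lt_rank (n : ℕ) {V : Type*} [NormedAddCommGroup V] [NormedSpace ℝ V]
    [Fact (finrank ℝ V = 2 * n + 1 + 1)] : 1 < Module.rank ℝ V := by
  have hV : finrank ℝ V = 2 * n + 1 + 1 := Fact.out
  have : FiniteDimensional ℝ V := Module.finite_of_finrank_pos (by omega)
  rw [← Module.finrank_eq_rank, hV]
  exact_mod_cast (by omega : 1 < 2 * n + 1 + 1)

variable {V : Type*} [NormedAddCommGroup V] [InnerProductSpace ℝ V]

/-- The pairs of a point `x` and a unit vector of the plane `ι x`. -/
def incidence (ι : X → OrientedPlane V) : Set (X × sphere (0 : V) 1) :=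
  {q | (q.2 : V) ∈ (ι q.1).plane}

theorem exists_unit_mem_plane (P : OrientedPlane V) : ∃ v : sphere (0 : V) 1, (v : V) ∈ P.plane := by
  have : Nontrivial P.plane := Module.nontrivial_of_finrank_pos (R := ℝ)
    (by rw [P.finrank_plane]; norm_num)
  obtain ⟨v, hv⟩ := exists_norm_eq P.plane zero_le_one
  exact ⟨⟨v, by simpa using hv⟩, v.2⟩

variable [Fact (finrank ℝ V = 2 * n + 1 + 1)]

/-- The projection is open because `v ↦ (σ v, v)` is a local section through any given pair, and
locally injective by `exists_nhds_unique`. -/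
theorem isLocalHomeomorph_incidence_snd [IsManifold (𝓡 (2 * n)) ∞ X] {ι : X → OrientedPlane V}
    (hι : IsGrassmannImmersion n ι) (hell : IsElliptic n ι) :
    IsLocalHomeomorph (fun q : incidence ι => q.1.2) := by
  have hcont : Continuous (fun q : incidence ι => q.1.2) :=
    continuous_snd.comp continuous_subtype_val
  have hopen : IsOpenMap (fun q : incidence ι => q.1.2) := by
    rw [isOpenMap_iff_nhds_le]
    rintro ⟨⟨x₀, v₀⟩, hv₀⟩ A hA
    obtain ⟨B, hB, hBA⟩ := mem_nhds_subtype _ _ _ |>.1 (mem_map.1 hA)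
    obtain ⟨σ, hσ, hσ0, hev⟩ := exists_local_section n hι hell (ne_zero_of_mem_unit_sphere v₀) hv₀
    have h1 : ContinuousAt (fun v : sphere (0 : V) 1 => σ v) v₀ :=
      ContinuousAt.comp (f := ((↑) : sphere (0 : V) 1 → V)) (g := σ) hσ.continuousAt
        continuous_subtype_val.continuousAt
    have h2 : Tendsto (fun v : sphere (0 : V) 1 => (σ v, v)) (𝓝 v₀) (𝓝 (x₀, v₀)) := by
      have := h1.prodMk (continuousAt_id (x := v₀))
      rw [ContinuousAt, hσ0] at this
      exact this
    have h3 : Tendsto (fun v : sphere (0 : V) 1 => (σ v, (v : V))) (𝓝 v₀) (𝓝 (x₀, (v₀ : V))) := by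
      have := h1.prodMk (continuous_subtype_val.continuousAt (x := v₀))
      rw [ContinuousAt, hσ0] at this
      exact this
    filter_upwards [h2 hB, h3.eventually hev] with v hv hv'
    have hmem : (σ v, v) ∈ incidence ι := hv'.2 rfl
    exact hBA (a := ⟨(σ v, v), hmem⟩) hv
  rw [isLocalHomeomorph_iff_isOpenEmbedding_restrict]
  rintro ⟨⟨x₀, v₀⟩, hv₀⟩
  obtain ⟨A, hA, B, hB, hAB⟩ := exists_nhds_unique n hι hell (ne_zero_of_mem_unit_sphere v₀) hv₀
  have hU : {q : incidence ι | q.1.1 ∈ interior A ∧ (q.1.2 : V) ∈ interior B} ∈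
      𝓝 (⟨(x₀, v₀), hv₀⟩ : incidence ι) ∧
      IsOpen {q : incidence ι | q.1.1 ∈ interior A ∧ (q.1.2 : V) ∈ interior B} := by
    have ho : IsOpen {q : incidence ι | q.1.1 ∈ interior A ∧ (q.1.2 : V) ∈ interior B} :=
      (isOpen_interior.preimage (continuous_fst.comp continuous_subtype_val)).inter
        (isOpen_interior.preimage (continuous_subtype_val.comp hcont))
    exact ⟨ho.mem_nhds ⟨mem_interior_iff_mem_nhds.2 hA, mem_interior_iff_mem_nhds.2 hB⟩, ho⟩
  refine ⟨_, hU.1, .of_continuous_injective_isOpenMap (hcont.comp continuous_subtype_val) ?_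
    (hopen.domRestrict hU.2)⟩
  rintro ⟨⟨⟨x, v⟩, hv⟩, hx1, hv1⟩ ⟨⟨⟨x', v'⟩, hv'⟩, hx2, _⟩ h
  have h' : v = v' := h
  subst h'
  have : x = x' := hAB v (interior_subset hv1) x (interior_subset hx1) x' (interior_subset hx2)
    hv hv'
  subst this
  rfl

theorem compactSpace_incidence [CompactSpace X] {ι : X → OrientedPlane V}
    (hι : IsGrassmannImmersion n ι) : CompactSpace (incidence ι) := by
  have hV : finrank ℝ V = 2 * n + 1 + 1 := Fact.out
  have : FiniteDimensional ℝ V := Module.finite_of_finrank_pos (by omega)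
  have : ProperSpace V := FiniteDimensional.proper_real V
  have hc : IsClosed (incidence ι) := (isClosed_incidence n hι).preimage
    (continuous_fst.prodMk (continuous_subtype_val.comp continuous_snd))
  exact isCompact_iff_compactSpace.1 hc.isCompact

/-- The range is open, compact and nonempty in a connected sphere. -/
theorem surjective_incidence_snd [IsManifold (𝓡 (2 * n)) ∞ X] [CompactSpace X] [Nonempty X]
    {ι : X → OrientedPlane V} (hι : IsGrassmannImmersion n ι) (hell : IsElliptic n ι) :
    Surjective (fun q : incidence ι => q.1.2) := by
  have := compactSpace_incidence n hι
  have hlh := isLocalHomeomorph_incidence_snd n hι hell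
  have : PreconnectedSpace (sphere (0 : V) 1) := isPreconnected_iff_preconnectedSpace.1
    (isPreconnected_sphere (one_lt_rank n) _ _)
  rw [← range_eq_univ]
  refine IsClopen.eq_univ ⟨(isCompact_range hlh.continuous).isClosed, hlh.isOpenMap.isOpen_range⟩ ?_
  obtain ⟨x⟩ := ‹Nonempty X›
  obtain ⟨v, hv⟩ := exists_unit_mem_plane (ι x)
  exact ⟨_, ⟨(x, v), hv⟩, rfl⟩

end Incidence

/-! ## The planes of a compact connected elliptic submanifold partition the sphere -/

/-! ### The space slit along a ray -/

section SlitSpace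

variable {V : Type*} [NormedAddCommGroup V] [NormedSpace ℝ V]

/-- The complement of the closed ray from `0` opposite to `N`. -/
def slitSpace (N : V) : Set V := ((fun t : ℝ => t • N) '' Iic 0)ᶜ

theorem mem_slitSpace {N v : V} : v ∈ slitSpace N ↔ ∀ t : ℝ, t ≤ 0 → t • N ≠ v := by
  simp [slitSpace]

theorem isOpen_slitSpace (N : V) : IsOpen (slitSpace N) :=
  (isClosedMap_smul_left N _ isClosed_Iic).isOpen_compl

theorem ne_zero_of_mem_slitSpace {N v : V} (hv : v ∈ slitSpace N) : v ≠ 0 := by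
  rintro rfl
  exact mem_slitSpace.1 hv 0 le_rfl (zero_smul ℝ N)

theorem self_mem_slitSpace {N : V} (hN : N ≠ 0) : N ∈ slitSpace N := by
  rw [mem_slitSpace]
  intro t ht h
  have : (t - 1) • N = 0 := by rw [sub_smul, h, one_smul, sub_self]
  rcases smul_eq_zero.1 this with h1 | h1
  · linarith
  · exact hN h1

/-- Provides a contractible domain for lifting. The sphere itself would not do for `n = 0`, where it
is a circle. -/
theorem starConvex_slitSpace {N : V} (hN : N ≠ 0) : StarConvex ℝ N (slitSpace N) := by
  intro v hv a b ha hb hab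
  rw [mem_slitSpace]
  intro t ht h
  rcases hb.eq_or_lt with rfl | hb
  · have : a = 1 := by linarith
    subst this
    rw [one_smul, zero_smul, add_zero] at h
    exact mem_slitSpace.1 (self_mem_slitSpace hN) t ht h
  -- Solving `a N + b v = t N` for `v` puts `v` on the removed ray, since `t ≤ 0 ≤ a`.
  · refine mem_slitSpace.1 hv (b⁻¹ * (t - a)) ?_ ?_
    · exact mul_nonpos_of_nonneg_of_nonpos (inv_nonneg.2 hb.le) (by linarith)
    · rw [mul_smul, sub_smul, h, add_sub_cancel_left, smul_smul, inv_mul_cancel₀ hb.ne', one_smul]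

/-- A plane containing `N` leaves a set star-shaped about `N`. Any other plane meets the ray only at
`0`, and a plane minus its origin is connected. -/
theorem isPreconnected_plane_inter_slitSpace (P : OrientedPlane V) {N : V} (hN : N ≠ 0) :
    IsPreconnected ((P.plane : Set V) ∩ slitSpace N) := by
  by_cases h : N ∈ P.plane
  · have hs : StarConvex ℝ N ((P.plane : Set V) ∩ slitSpace N) :=
      (P.plane.convex.starConvex h).inter (starConvex_slitSpace hN)
    exact (hs.isPathConnected ⟨h, self_mem_slitSpace hN⟩).isConnected.isPreconnected
  · have hfin : FiniteDimensional ℝ P.plane :=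
      Module.finite_of_finrank_pos (by rw [P.finrank_plane]; norm_num)
    have hr : 1 < Module.rank ℝ P.plane := by
      rw [← Module.finrank_eq_rank, P.finrank_plane]
      exact_mod_cast one_lt_two
    have hc := (isConnected_compl_singleton_of_one_lt_rank hr (0 : P.plane)).isPreconnected
    convert hc.image ((↑) : P.plane → V) continuous_subtype_val.continuousOn using 1
    ext v
    constructor
    · rintro ⟨hv, hv'⟩
      exact ⟨⟨v, hv⟩, fun h0 => ne_zero_of_mem_slitSpace hv' (congrArg Subtype.val h0), rfl⟩
    · rintro ⟨⟨v, hv⟩, hv', rfl⟩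
      refine ⟨hv, mem_slitSpace.2 fun t ht he => ?_⟩
      have he' : t • N = v := he
      rcases eq_or_ne t 0 with rfl | h0
      · rw [zero_smul] at he'
        exact hv' (Subtype.ext he'.symm)
      · refine h ?_
        rw [← inv_smul_smul₀ h0 N, he']
        exact P.plane.smul_mem _ hv

/-- Of two opposite nonzero vectors, at most one lies on the ray. -/
theorem exists_mem_plane_inter_slitSpace (P : OrientedPlane V) (N : V) :
    ∃ v, v ∈ P.plane ∧ v ∈ slitSpace N := by
  have : Nontrivial P.plane := Module.nontrivial_of_finrank_pos (R := ℝ)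
    (by rw [P.finrank_plane]; norm_num)
  obtain ⟨v, hv⟩ := exists_ne (0 : P.plane)
  by_cases h : (v : V) ∈ slitSpace N
  · exact ⟨v, v.2, h⟩
  · refine ⟨-v, P.plane.neg_mem v.2, mem_slitSpace.2 fun t ht he => ?_⟩
    simp only [mem_slitSpace, not_forall, not_not] at h
    obtain ⟨s, hs, hsv⟩ := h
    have h0 : (t + s) • N = 0 := by rw [add_smul, he, hsv, neg_add_cancel]
    have hv' : (v : V) ≠ 0 := fun h => hv (Subtype.ext h)
    rcases smul_eq_zero.1 h0 with h1 | h1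
    · have : s = 0 := by linarith
      rw [this, zero_smul] at hsv
      exact hv' hsv.symm
    · rw [h1, smul_zero] at hsv
      exact hv' hsv.symm

end SlitSpace

/-! ### Exactly one plane through each nonzero vector -/

section Partition

open OrientedPlane Filter

variable (n : ℕ) {X : Type*} [TopologicalSpace X]
  [ChartedSpace (EuclideanSpace ℝ (Fin (2 * n))) X] [IsManifold (𝓡 (2 * n)) ∞ X]
  {V : Type*} [NormedAddCommGroup V] [InnerProductSpace ℝ V] [Fact (finrank ℝ V = 2 * n + 1 + 1)]

/-- Lift the radial projection of the slit space to the sphere through the incidence covering, and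
take the `X`-component of the lift. -/
theorem exists_section_slitSpace [T2Space X] [CompactSpace X] [Nonempty X] {ι : X → OrientedPlane V}
    (hι : IsGrassmannImmersion n ι) (hell : IsElliptic n ι) {N : V} (hN : N ≠ 0) :
    ∃ σ : V → X, ContinuousOn σ (slitSpace N) ∧ ∀ v ∈ slitSpace N, v ∈ (ι (σ v)).plane := by
  have := compactSpace_incidence n hι
  -- Compactness of the incidence space turns the local homeomorphism into a covering.
  have hcov := isLocalHomeomorph_iff_isCoveringMap.1 (isLocalHomeomorph_incidence_snd n hι hell)
  have : ContractibleSpace (slitSpace N) :=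
    (starConvex_slitSpace hN).contractibleSpace ⟨N, self_mem_slitSpace hN⟩
  have : LocallyPathConnectedSpace (slitSpace N) := (isOpen_slitSpace N).locallyPathConnectedSpace
  let f : C(slitSpace N, sphere (0 : V) 1) :=
    { toFun := fun v => ⟨‖(v : V)‖⁻¹ • (v : V), by
        rw [mem_sphere_zero_iff_norm, norm_smul, norm_inv, norm_norm,
          inv_mul_cancel₀ (norm_ne_zero_iff.2 (ne_zero_of_mem_slitSpace v.2))]⟩
      continuous_toFun := continuous_induced_rng.2
        ((continuous_subtype_val.norm.inv₀ fun v => norm_ne_zero_iff.2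
          (ne_zero_of_mem_slitSpace v.2)).smul continuous_subtype_val) }
  let a₀ : slitSpace N := ⟨N, self_mem_slitSpace hN⟩
  obtain ⟨e₀, he₀⟩ := surjective_incidence_snd n hι hell (f a₀)
  obtain ⟨F, ⟨-, hF⟩, -⟩ := hcov.existsUnique_continuousMap_lifts f a₀ e₀ he₀
  obtain ⟨x₀⟩ := ‹Nonempty X›
  classical
  refine ⟨fun v => if h : v ∈ slitSpace N then (F ⟨v, h⟩).1.1 else x₀, ?_, fun v hv => ?_⟩
  · rw [continuousOn_iff_continuous_domRestrict]
    have : Continuous fun v : slitSpace N => (F v).1.1 :=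
      continuous_fst.comp (continuous_subtype_val.comp F.continuous)
    convert this using 1
    ext v
    simp
  · show v ∈ (ι (dite _ _ _)).plane
    rw [dif_pos hv]
    have h1 : (F ⟨v, hv⟩).1.2 = f ⟨v, hv⟩ := congrFun hF ⟨v, hv⟩
    have h2 : ((F ⟨v, hv⟩).1.2 : V) ∈ (ι (F ⟨v, hv⟩).1.1).plane := (F ⟨v, hv⟩).2
    have h3 : ((F ⟨v, hv⟩).1.2 : V) = ‖v‖⁻¹ • v := congrArg Subtype.val h1
    rw [h3] at h2
    exact (Submodule.smul_mem_iff _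
      (inv_ne_zero (norm_ne_zero_iff.2 (ne_zero_of_mem_slitSpace hv)))).1 h2

/-- By continuity `σ v` stays near `σ w`, so local uniqueness identifies it with any other nearby
`x` whose plane contains `v`. -/
theorem section_eventuallyEq {ι : X → OrientedPlane V}
    (hι : IsGrassmannImmersion n ι) (hell : IsElliptic n ι) {Ω : Set V} (hΩ : IsOpen Ω)
    (hΩ0 : ∀ v ∈ Ω, v ≠ 0) {σ : V → X} (hσ : ContinuousOn σ Ω)
    (hσι : ∀ v ∈ Ω, v ∈ (ι (σ v)).plane) {w : V} (hw : w ∈ Ω) :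
    ∀ᶠ q : X × V in 𝓝 (σ w, w), q.2 ∈ (ι q.1).plane → σ q.2 = q.1 := by
  obtain ⟨A, hA, B, hB, hAB⟩ := exists_nhds_unique n hι hell (hΩ0 w hw) (hσι w hw)
  have h1 := (hσ.continuousAt (hΩ.mem_nhds hw)) hA
  have h2 : ∀ᶠ v in 𝓝 w, σ v ∈ A ∧ v ∈ B ∧ v ∈ Ω := by
    filter_upwards [h1, hB, hΩ.mem_nhds hw] with v h h' h'' using ⟨h, h', h''⟩
  filter_upwards [continuousAt_snd h2, continuousAt_fst hA] with q hq hq' hmem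
  exact hAB _ hq.2.1 _ hq.1 _ hq' (hσι _ hq.2.2) hmem

theorem existsUnique_mem_plane [T2Space X] [CompactSpace X] [ConnectedSpace X] {ι : X → OrientedPlane V}
    (hι : IsGrassmannImmersion n ι) (hell : IsElliptic n ι) {N : V} (hN : N ≠ 0) :
    ∃! x, N ∈ (ι x).plane := by
  set Ω := slitSpace N with hΩdef
  have hΩ : IsOpen Ω := isOpen_slitSpace N
  obtain ⟨σ, hσ, hσι⟩ := exists_section_slitSpace n hι hell hN
  have hev {w : V} (hw : w ∈ Ω) := section_eventuallyEq n hι hell hΩ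
    (fun v => ne_zero_of_mem_slitSpace) hσ hσι hw
  -- On the connected set `ι (σ v) ∩ Ω`, the locus where `σ` takes the value `σ v` is closed. It is
  -- open by local uniqueness, as nearby vectors also lie in `ι (σ v)`.
  have hconst : ∀ v ∈ Ω, ∀ w ∈ Ω, w ∈ (ι (σ v)).plane → σ w = σ v := by
    intro v hv w hw hwv
    set C := ((ι (σ v)).plane : Set V) ∩ Ω
    have : PreconnectedSpace C := isPreconnected_iff_preconnectedSpace.1
      (isPreconnected_plane_inter_slitSpace (ι (σ v)) hN)
    have hσC : Continuous fun u : C => σ u :=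
      continuousOn_iff_continuous_domRestrict.1 (hσ.mono inter_subset_right)
    have hclopen : IsClopen {u : C | σ u = σ v} := by
      refine ⟨isClosed_eq hσC continuous_const, isOpen_iff_mem_nhds.2 ?_⟩
      intro u hu
      have h1 := hev u.2.2
      rw [show σ u = σ v from hu] at h1
      have h2 : Tendsto (fun y : C => (σ v, (y : V))) (𝓝 u) (𝓝 (σ v, (u : V))) :=
        (continuous_const.prodMk continuous_subtype_val).continuousAt
      filter_upwards [h2.eventually h1] with y hy using hy y.2.1
    have := hclopen.eq_univ ⟨⟨v, hσι v hv, hv⟩, rfl⟩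
    exact (Set.ext_iff.1 this ⟨w, hwv, hw⟩).2 trivial
  have hrange : IsClopen (σ '' Ω) := by
    constructor
    -- For `x` in the closure, carry a vector `w` of `ι x` along as `g y ∈ ι y`. For `y` in the
    -- range, `hconst` gives `σ (g y) = y`; letting `y → x` gives `σ w = x`.
    · rw [← closure_subset_iff_isClosed]
      intro x hx
      obtain ⟨w, hwx, hw⟩ := exists_mem_plane_inter_slitSpace (ι x) N
      obtain ⟨g, hg, hgx, hgι⟩ := exists_local_frame_through n hι hwx
      refine ⟨w, hw, ?_⟩
      have : (𝓝[σ '' Ω] x).NeBot := mem_closure_iff_nhdsWithin_neBot.1 hx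
      have h1 : Tendsto (fun y => σ (g y)) (𝓝[σ '' Ω] x) (𝓝 (σ w)) := by
        have h := ContinuousAt.comp (f := g) (g := σ) (x := x)
          (by rw [hgx]; exact hσ.continuousAt (hΩ.mem_nhds hw)) hg
        rw [ContinuousAt, Function.comp_apply, hgx] at h
        exact h.mono_left nhdsWithin_le_nhds
      have hgΩ : ∀ᶠ y in 𝓝 x, g y ∈ Ω := hg (by rw [hgx]; exact hΩ.mem_nhds hw)
      have h2 : Tendsto (fun y => σ (g y)) (𝓝[σ '' Ω] x) (𝓝 x) := by
        refine (tendsto_id.mono_left nhdsWithin_le_nhds).congr' ?_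
        filter_upwards [self_mem_nhdsWithin, nhdsWithin_le_nhds hgι, nhdsWithin_le_nhds hgΩ]
          with y hy h3 h4
        obtain ⟨v, hv, rfl⟩ := hy
        exact (hconst v hv _ h4 h3).symm
      exact tendsto_nhds_unique h1 h2
    -- Near `σ w`, carrying `w` along gives `σ (g y) = y` by local uniqueness.
    · rw [isOpen_iff_mem_nhds]
      rintro _ ⟨w, hw, rfl⟩
      obtain ⟨g, hg, hgx, hgι⟩ := exists_local_frame_through n hι (hσι w hw)
      have hgΩ : ∀ᶠ y in 𝓝 (σ w), g y ∈ Ω := hg (by rw [hgx]; exact hΩ.mem_nhds hw)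
      have h1 : Tendsto (fun y => (y, g y)) (𝓝 (σ w)) (𝓝 (σ w, w)) := by
        have := continuousAt_id.prodMk hg
        rw [ContinuousAt, hgx] at this
        exact this
      filter_upwards [hgι, hgΩ, h1.eventually (hev hw)] with y h2 h3 h4
      exact ⟨g y, h3, h4 h2⟩
  have hNΩ : N ∈ Ω := self_mem_slitSpace hN
  have huniv := hrange.eq_univ ⟨_, N, hNΩ, rfl⟩
  refine ⟨σ N, hσι N hNΩ, fun x hx => ?_⟩
  -- Connectedness of `X` enters here: every plane through `N` is some `ι (σ v)`, and `hconst`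
  -- compares `v` with `N`.
  obtain ⟨v, hv, rfl⟩ : x ∈ σ '' Ω := huniv ▸ mem_univ x
  exact (hconst v hv N hNΩ hx).symm

end Partition

/-! ## Smooth maps to spheres -/

section SphereProj

section Normed

variable {E : Type*} [NormedAddCommGroup E] [NormedSpace ℝ E]

/-- The radial projection to the unit sphere, with value `e` at the origin. -/
noncomputable def sphereProj (e : sphere (0 : E) 1) (v : E) : sphere (0 : E) 1 :=
  open Classical in
  if h : v = 0 then e else ⟨‖v‖⁻¹ • v, by
    rw [mem_sphere_zero_iff_norm, norm_smul, norm_inv, norm_norm,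
      inv_mul_cancel₀ (norm_ne_zero_iff.2 h)]⟩

theorem coe_sphereProj (e : sphere (0 : E) 1) {v : E} (h : v ≠ 0) :
    (sphereProj e v : E) = ‖v‖⁻¹ • v := by
  rw [sphereProj, dif_neg h]

theorem sphereProj_coe (e s : sphere (0 : E) 1) : sphereProj e (s : E) = s := by
  apply Subtype.ext
  rw [coe_sphereProj e (ne_zero_of_mem_unit_sphere s), norm_eq_of_mem_sphere, inv_one, one_smul]

theorem sphereProj_smul (e : sphere (0 : E) 1) {r : ℝ} (hr : 0 < r) (v : E) :
    sphereProj e (r • v) = sphereProj e v := by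
  rcases eq_or_ne v 0 with rfl | h
  · rw [smul_zero]
  · apply Subtype.ext
    rw [coe_sphereProj e h, coe_sphereProj e (smul_ne_zero hr.ne' h), norm_smul, Real.norm_eq_abs,
      abs_of_pos hr, smul_smul, mul_inv_rev, mul_assoc, inv_mul_cancel₀ hr.ne', mul_one]

end Normed

variable {E : Type*} [NormedAddCommGroup E] [InnerProductSpace ℝ E]
  {F : Type*} [NormedAddCommGroup F] [NormedSpace ℝ F]
  {H : Type*} [TopologicalSpace H] {I : ModelWithCorners ℝ F H}
  {M : Type*} [TopologicalSpace M] [ChartedSpace H M]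

/-- The chart at `f x` is stereographic projection from `-(f x)`, whose formula is smooth on an open
subset of the ambient space containing `f x`. -/
theorem ContMDiffAt.of_coe_sphere {m : ℕ∞} {k : ℕ} [Fact (finrank ℝ E = k + 1)]
    {f : M → sphere (0 : E) 1} {x : M}
    (hf : ContMDiffAt I 𝓘(ℝ, E) m (fun y => (f y : E)) x) : ContMDiffAt I (𝓡 k) m f x := by
  rw [contMDiffAt_iff_target]
  refine ⟨IsInducing.subtypeVal.continuousAt_iff.2 hf.continuousAt, ?_⟩
  let U : _ ≃ₗᵢ[ℝ] _ :=
    (OrthonormalBasis.fromOrthogonalSpanSingleton k (ne_zero_of_mem_unit_sphere (-(f x)))).repr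
  have hopen : {y : E | inner ℝ ((-(f x) : sphere (0 : E) 1) : E) y ≠ 1} ∈ 𝓝 (f x : E) := by
    refine (isOpen_ne_fun (by fun_prop) continuous_const).mem_nhds ?_
    have h1 : ‖(f x : E)‖ = 1 := norm_eq_of_mem_sphere (f x)
    show inner ℝ ((-(f x) : sphere (0 : E) 1) : E) (f x : E) ≠ 1
    rw [coe_neg_sphere, inner_neg_left, real_inner_self_eq_norm_sq, h1]
    norm_num
  have h1 : ContDiffAt ℝ m (fun y => U (stereoToFun ((-(f x) : sphere (0 : E) 1) : E) y))
      (f x : E) :=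
    U.contDiff.contDiffAt.comp _ (contDiffOn_stereoToFun.contDiffAt hopen)
  exact ContMDiffAt.comp (f := fun y => (f y : E))
    (g := fun y => U (stereoToFun ((-(f x) : sphere (0 : E) 1) : E) y)) x h1.contMDiffAt hf

theorem contMDiffAt_sphereProj {m : ℕ∞} {k : ℕ} [Fact (finrank ℝ E = k + 1)]
    (e : sphere (0 : E) 1) {v : E} (hv : v ≠ 0) :
    ContMDiffAt 𝓘(ℝ, E) (𝓡 k) m (sphereProj e) v := by
  apply ContMDiffAt.of_coe_sphere
  have h : ContDiffAt ℝ m (fun v : E => ‖v‖⁻¹ • v) v :=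
    ((contDiffAt_norm ℝ hv).inv (norm_ne_zero_iff.2 hv)).smul contDiffAt_id
  refine h.contMDiffAt.congr_of_eventuallyEq ?_
  filter_upwards [isOpen_ne.mem_nhds hv] with y hy using coe_sphereProj e hy

attribute [local instance] finrank_real_complex_fact'

/-- The radial projection of `ℂ` to the circle. -/
noncomputable def circleProj (z : ℂ) : Circle := sphereProj (E := ℂ) ⟨1, by simp⟩ z

theorem circleProj_coe (c : Circle) : circleProj (c : ℂ) = c := sphereProj_coe (E := ℂ) _ c

theorem circleProj_smul {r : ℝ} (hr : 0 < r) (z : ℂ) : circleProj (r • z) = circleProj z :=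
  sphereProj_smul (E := ℂ) _ hr z

theorem coe_circleProj {z : ℂ} (hz : z ≠ 0) : (circleProj z : ℂ) = ‖z‖⁻¹ • z :=
  coe_sphereProj (E := ℂ) _ hz

theorem contMDiffAt_circleProj {m : ℕ∞} {z : ℂ} (hz : z ≠ 0) :
    ContMDiffAt 𝓘(ℝ, ℂ) (𝓡 1) m circleProj z :=
  contMDiffAt_sphereProj (E := ℂ) _ hz

theorem contMDiff_circle_coe {m : ℕ∞} : ContMDiff (𝓡 1) 𝓘(ℝ, ℂ) m (fun c : Circle => (c : ℂ)) :=
  contMDiff_coe_sphere (E := ℂ)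

/-- Real coordinates on `ℂ`. -/
noncomputable def complexCoord : ℂ ≃L[ℝ] (Fin 2 → ℝ) := Complex.basisOneI.equivFun.toContinuousLinearEquiv

end SphereProj

/-! ## The equivalence -/

section Equivalence

open OrientedPlane Filter

variable (n : ℕ) {X : Type*} [TopologicalSpace X] [ChartedSpace (EuclideanSpace ℝ (Fin (2 * n))) X]
  {V : Type*} [NormedAddCommGroup V] [InnerProductSpace ℝ V] [Fact (finrank ℝ V = 2 * n + 1 + 1)]

theorem IsGreatCircleFibration.contMDiff {π : sphere (0 : V) 1 → X}
    (hπ : IsGreatCircleFibration n π) : ContMDiff (𝓡 (2 * n + 1)) (𝓡 (2 * n)) ∞ π := by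
  intro s
  obtain ⟨e, he, hsm, -⟩ := hπ.locallyTrivial (π s)
  have hs : e.source ∈ 𝓝 s := e.open_source.mem_nhds (e.mem_source.2 he)
  refine (contMDiffAt_fst.comp s (hsm.contMDiffAt hs)).congr_of_eventuallyEq ?_
  filter_upwards [hs] with t ht using (e.coe_fst ht).symm

theorem connectedSpace_sphere (n : ℕ) {V : Type*} [NormedAddCommGroup V] [NormedSpace ℝ V]
    [Fact (finrank ℝ V = 2 * n + 1 + 1)] : ConnectedSpace (sphere (0 : V) 1) :=
  isConnected_iff_connectedSpace.1 (isConnected_sphere (one_lt_rank n) _ zero_le_one)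

/-- The section `z ↦ (a, S(z) a)` of the planes has the smooth left inverse induced by `π`, so its
derivative is injective. -/
theorem isElliptic_of_fibration [IsManifold (𝓡 (2 * n)) ∞ X] {ι : X → OrientedPlane V}
    (hι : IsGrassmannImmersion n ι) {π : sphere (0 : V) 1 → X} (hπ : IsGreatCircleFibration n π)
    (hfib : ∀ x : X, π ⁻¹' {x} = greatCircle (ι x)) : IsElliptic n ι := by
  rw [isElliptic_iff n hι]
  intro x a ha ξ hξ
  obtain ⟨e, -⟩ := exists_unit_mem_plane (ι x)
  set c := extChartAt (𝓡 (2 * n)) x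
  set φ := adapted (m := 2 * n) (ι x)
  have hx := mem_source_adapted (m := 2 * n) (ι x)
  have hne : ∀ y, localFrame n ι x y a ≠ 0 := by
    intro y h
    have h1 := xPart_localFrame n ι x y a
    rw [h, map_zero] at h1
    exact ha h1.symm
  have hproj : ∀ v : V, v ≠ 0 → ∀ y, v ∈ (ι y).plane → π (sphereProj e v) = y := by
    intro v hv y hvy
    have : sphereProj e v ∈ greatCircle (ι y) := by
      show (sphereProj e v : V) ∈ (ι y).plane
      rw [coe_sphereProj e hv]
      exact (ι y).plane.smul_mem _ hvy
    rw [← hfib y] at this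
    exact this
  have hH : HasFDerivAt (fun z => φ.symm (a, chartSlope n ι x z a))
      ((φ.symm : (Fin 2 → ℝ) × (Fin (2 * n) → ℝ) →L[ℝ] V).comp
        ((0 : EuclideanSpace ℝ (Fin (2 * n)) →L[ℝ] (Fin 2 → ℝ)).prod
          ((slopeDeriv n ι x).flip a))) (c x) := by
    have h1 : HasFDerivAt (chartSlope n ι x) (slopeDeriv n ι x) (c x) := by
      rw [← fderiv_chartSlope n hι x]
      exact ((contDiffAt_chartSlope n hι x).differentiableAt (by simp)).hasFDerivAt
    have h2 : HasFDerivAt (fun z => chartSlope n ι x z a) ((slopeDeriv n ι x).flip a) (c x) := by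
      have := h1.clm_apply (hasFDerivAt_const a (c x))
      simpa using this
    exact (φ.symm : (Fin 2 → ℝ) × (Fin (2 * n) → ℝ) →L[ℝ] V).hasFDerivAt.comp (c x)
      ((hasFDerivAt_const a (c x)).prodMk h2)
  have hcx : c.symm (c x) = x := extChartAt_to_inv x
  set w := φ.symm (a, chartSlope n ι x (c x) a) with hw
  have hw' : w = localFrame n ι x x a := by
    show φ.symm (a, slope φ (ι (c.symm (c x))) a) = _
    rw [hcx]
    rfl
  have hπw : π (sphereProj e w) = x := by
    rw [hw']
    exact hproj _ (hne x) x (localFrame_mem n ι hx a)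
  have hG : DifferentiableAt ℝ (fun v => c (π (sphereProj e v))) w := by
    have h1 : ContMDiffAt 𝓘(ℝ, V) (𝓡 (2 * n)) ∞ (fun v => π (sphereProj e v)) w :=
      ContMDiffAt.comp (g := π) (f := sphereProj e) w (hπ.contMDiff n _)
        (contMDiffAt_sphereProj e (by rw [hw']; exact hne x))
    have h2 := ContMDiffAt.comp (g := c) (f := fun v => π (sphereProj e v)) w
      (by rw [hπw]; exact contMDiffAt_extChartAt) h1
    exact h2.contDiffAt.differentiableAt (by simp)
  have hcomp := hG.hasFDerivAt.comp (c x) hH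
  -- The fibre through a unit vector of `ι y` lies over `y`.
  have hid : (fun z => c (π (sphereProj e (φ.symm (a, chartSlope n ι x z a))))) =ᶠ[𝓝 (c x)] id := by
    have h1 : ∀ᶠ z in 𝓝 (c x), ι (c.symm z) ∈ (graphChart φ).source :=
      (continuousAt_extChartAt_symm x) (by
        show _ ∈ 𝓝 (c.symm (c x))
        rw [hcx]
        exact preimage_source_mem_nhds n hι x)
    filter_upwards [h1, extChartAt_target_mem_nhds x] with z hz hz'
    have h2 := hproj _ (hne _) _ (localFrame_mem n ι hz a)
    show c (π (sphereProj e (localFrame n ι x (c.symm z) a))) = z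
    rw [h2]
    exact c.right_inv hz'
  -- By the chain rule `ξ` is the image of `(0, S'(ξ) a) = 0`.
  have huniq := (hasFDerivAt_id (c x)).unique (hcomp.congr_of_eventuallyEq hid.symm)
  have h3 := congrArg (fun A => A ξ) huniq
  simpa [hξ, ← Prod.zero_eq_mk] using h3

theorem isElliptic_and_of_isBase [IsManifold (𝓡 (2 * n)) ∞ X] {ι : X → OrientedPlane V}
    (hι : IsGrassmannImmersion n ι) (h : IsBaseOfGreatCircleFibration n ι) :
    IsElliptic n ι ∧ CompactSpace X ∧ ConnectedSpace X := by
  obtain ⟨π, hπ, hfib⟩ := h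
  have hV : finrank ℝ V = 2 * n + 1 + 1 := Fact.out
  have : FiniteDimensional ℝ V := Module.finite_of_finrank_pos (by omega)
  have : ProperSpace V := FiniteDimensional.proper_real V
  have hsurj : Surjective π := by
    intro x
    obtain ⟨v, hv⟩ := exists_unit_mem_plane (ι x)
    have : v ∈ π ⁻¹' {x} := by rw [hfib x]; exact hv
    exact ⟨v, this⟩
  have hcont : Continuous π := (hπ.contMDiff n).continuous
  have := connectedSpace_sphere n (V := V)
  refine ⟨isElliptic_of_fibration n hι hπ hfib, ⟨?_⟩, hsurj.connectedSpace hcont⟩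
  rw [← hsurj.range_eq]
  exact isCompact_range hcont

theorem contMDiffOn_localFrame_circle {ι : X → OrientedPlane V} (hι : IsGrassmannImmersion n ι)
    (x₀ : X) : ContMDiffOn ((𝓡 (2 * n)).prod (𝓡 1)) 𝓘(ℝ, V) ∞
      (fun q : X × Circle => localFrame n ι x₀ q.1 (complexCoord (q.2 : ℂ)))
      ((ι ⁻¹' (graphChart (adapted (m := 2 * n) (ι x₀))).source) ×ˢ univ) := by
  have h1 : ContMDiff ((𝓡 (2 * n)).prod (𝓡 1)) 𝓘(ℝ, ℂ) ∞ (fun q : X × Circle => (q.2 : ℂ)) :=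
    ContMDiff.comp (g := fun c : Circle => (c : ℂ)) (f := Prod.snd)
      contMDiff_circle_coe contMDiff_snd
  have h2 : ContMDiff ((𝓡 (2 * n)).prod (𝓡 1)) 𝓘(ℝ, Fin 2 → ℝ) ∞
      (fun q : X × Circle => complexCoord (q.2 : ℂ)) :=
    ContMDiff.comp (g := complexCoord) (f := fun q : X × Circle => (q.2 : ℂ))
      complexCoord.contDiff.contMDiff h1
  have h3 : ContMDiff ((𝓡 (2 * n)).prod (𝓡 1)) ((𝓡 (2 * n)).prod 𝓘(ℝ, Fin 2 → ℝ)) ∞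
      (fun q : X × Circle => (q.1, complexCoord (q.2 : ℂ))) := contMDiff_fst.prodMk h2
  exact ContMDiffOn.comp (g := fun q : X × (Fin 2 → ℝ) => localFrame n ι x₀ q.1 q.2)
    (f := fun q : X × Circle => (q.1, complexCoord (q.2 : ℂ)))
    (contMDiffOn_localFrame n hι x₀) h3.contMDiffOn fun q hq => ⟨hq.1, mem_univ _⟩

/-! ### Smoothness and local triviality of the projection -/

section Converse

variable {ι : X → OrientedPlane V} (hι : IsGrassmannImmersion n ι) {π : V → X}
  (hπ : ∀ v : V, v ≠ 0 → ∀ x, v ∈ (ι x).plane ↔ π v = x)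

include hι hπ

/-- Since a nonzero vector lies in only one plane, `π` coincides near `v` with the smooth local
solution. -/
theorem contMDiffAt_of_mem_plane_iff [IsManifold (𝓡 (2 * n)) ∞ X] (hell : IsElliptic n ι)
    {v : V} (hv : v ≠ 0) : ContMDiffAt 𝓘(ℝ, V) (𝓡 (2 * n)) ∞ π v := by
  obtain ⟨σ, hσ, hσ0, hev⟩ := exists_local_section n hι hell hv ((hπ v hv _).2 rfl)
  refine hσ.congr_of_eventuallyEq ?_
  have h1 : Tendsto (fun w => (σ w, w)) (𝓝 v) (𝓝 (π v, v)) := by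
    have := hσ.continuousAt.prodMk (continuousAt_id (x := v))
    rw [ContinuousAt, hσ0] at this
    exact this
  filter_upwards [h1.eventually hev, isOpen_ne.mem_nhds hv] with w hw hw0
  exact (hπ w hw0 _).1 (hw.2 rfl)

/-- The fibre coordinate is the direction of the `x`-part. The identification of a plane with `ℝ²`
is linear but need not be isometric, so both directions normalize; positive rescaling does not
change the result. -/
theorem exists_trivialization [IsManifold (𝓡 (2 * n)) ∞ X] (hell : IsElliptic n ι) (x₀ : X) :
    ∃ e : Bundle.Trivialization Circle (fun s : sphere (0 : V) 1 => π s), x₀ ∈ e.baseSet ∧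
      ContMDiffOn (𝓡 (2 * n + 1)) ((𝓡 (2 * n)).prod (𝓡 1)) ∞ e e.source ∧
      ContMDiffOn ((𝓡 (2 * n)).prod (𝓡 1)) (𝓡 (2 * n + 1)) ∞
        e.toOpenPartialHomeomorph.symm e.target := by
  obtain ⟨e₀, -⟩ := exists_unit_mem_plane (ι x₀)
  set φ := adapted (m := 2 * n) (ι x₀)
  set U := ι ⁻¹' (graphChart φ).source
  have hU : IsOpen U := isOpen_preimage_source n hι x₀
  have hπs : ContMDiff (𝓡 (2 * n + 1)) (𝓡 (2 * n)) ∞ (fun s : sphere (0 : V) 1 => π s) := fun s =>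
    ContMDiffAt.comp (g := π) (f := ((↑) : sphere (0 : V) 1 → V)) s
      (contMDiffAt_of_mem_plane_iff n hι hπ hell (ne_zero_of_mem_unit_sphere s))
      contMDiff_coe_sphere.contMDiffAt
  have hmem : ∀ s : sphere (0 : V) 1, (s : V) ∈ (ι (π s)).plane := fun s =>
    (hπ s (ne_zero_of_mem_unit_sphere s) _).2 rfl
  let fwd : sphere (0 : V) 1 → X × Circle := fun s =>
    (π s, circleProj (complexCoord.symm (xPart φ s)))
  let bwd : X × Circle → sphere (0 : V) 1 := fun q =>
    sphereProj e₀ (localFrame n ι x₀ q.1 (complexCoord (q.2 : ℂ)))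
  have hfr : ∀ (x : X) (c : Circle), localFrame n ι x₀ x (complexCoord (c : ℂ)) ≠ 0 := by
    intro x c h
    have h1 := xPart_localFrame n ι x₀ x (complexCoord (c : ℂ))
    rw [h, map_zero] at h1
    exact c.coe_ne_zero (complexCoord.map_eq_zero_iff.1 h1.symm)
  have hxs : ∀ s : sphere (0 : V) 1, π s ∈ U → complexCoord.symm (xPart φ s) ≠ 0 := fun s hs h =>
    xPart_ne_zero n hs (hmem s) (ne_zero_of_mem_unit_sphere s)
      (complexCoord.symm.map_eq_zero_iff.1 h)
  have hπb : ∀ q : X × Circle, q.1 ∈ U → π (bwd q) = q.1 := by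
    intro q hq
    refine (hπ _ (ne_zero_of_mem_unit_sphere _) _).1 ?_
    show (sphereProj e₀ _ : V) ∈ _
    rw [coe_sphereProj e₀ (hfr _ _)]
    exact (ι q.1).plane.smul_mem _ (localFrame_mem n ι hq _)
  have hfwd : ContMDiffOn (𝓡 (2 * n + 1)) ((𝓡 (2 * n)).prod (𝓡 1)) ∞ fwd
      ((fun s : sphere (0 : V) 1 => π s) ⁻¹' U) := by
    intro s hs
    apply ContMDiffAt.contMDiffWithinAt
    refine (hπs s).prodMk ?_
    have h1 : ContMDiffAt (𝓡 (2 * n + 1)) 𝓘(ℝ, ℂ) ∞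
        (fun s : sphere (0 : V) 1 => complexCoord.symm (xPart φ s)) s :=
      ContMDiffAt.comp (g := fun v : V => complexCoord.symm (xPart φ v))
        (f := ((↑) : sphere (0 : V) 1 → V)) s
        (complexCoord.symm.contDiff.comp (xPart φ).contDiff).contMDiff.contMDiffAt
        contMDiff_coe_sphere.contMDiffAt
    exact ContMDiffAt.comp (g := circleProj) s (contMDiffAt_circleProj (hxs s hs)) h1
  have hbwd : ContMDiffOn ((𝓡 (2 * n)).prod (𝓡 1)) (𝓡 (2 * n + 1)) ∞ bwd (U ×ˢ univ) := by
    intro q hq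
    exact ContMDiffAt.comp_contMDiffWithinAt (g := sphereProj e₀)
      (f := fun q : X × Circle => localFrame n ι x₀ q.1 (complexCoord (q.2 : ℂ))) q
      (contMDiffAt_sphereProj e₀ (hfr q.1 q.2)) (contMDiffOn_localFrame_circle n hι x₀ q hq)
  have hleft : ∀ s : sphere (0 : V) 1, π s ∈ U → bwd (fwd s) = s := by
    intro s hs
    have h0 := hxs s hs
    show sphereProj e₀ (localFrame n ι x₀ (π s)
      (complexCoord (circleProj (complexCoord.symm (xPart φ s)) : ℂ))) = s
    -- The frame is linear in `a`, so the normalizing factor comes out and is absorbed by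
    -- `sphereProj`.
    rw [coe_circleProj h0, map_smul, ContinuousLinearEquiv.apply_symm_apply, localFrame, map_smul]
    change sphereProj e₀ (_ • localFrame n ι x₀ (π s) (xPart φ s)) = s
    rw [sphereProj_smul e₀ (inv_pos.2 (norm_pos_iff.2 h0)), localFrame_xPart n ι hs (hmem s),
      sphereProj_coe]
  have hright : ∀ q : X × Circle, q.1 ∈ U → fwd (bwd q) = q := by
    intro q hq
    refine Prod.ext (hπb q hq) ?_
    show circleProj (complexCoord.symm (xPart φ (sphereProj e₀
      (localFrame n ι x₀ q.1 (complexCoord (q.2 : ℂ))) : V))) = q.2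
    rw [coe_sphereProj e₀ (hfr _ _), map_smul, map_smul, xPart_localFrame,
      ContinuousLinearEquiv.symm_apply_apply,
      circleProj_smul (inv_pos.2 (norm_pos_iff.2 (hfr _ _))), circleProj_coe]
  let e : Bundle.Trivialization Circle (fun s : sphere (0 : V) 1 => π s) :=
    { toFun := fwd
      invFun := bwd
      source := (fun s : sphere (0 : V) 1 => π s) ⁻¹' U
      target := U ×ˢ univ
      map_source' := fun s hs => ⟨hs, mem_univ _⟩
      map_target' := fun q hq => by
        show π (bwd q) ∈ U
        rw [hπb q hq.1]
        exact hq.1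
      left_inv' := fun s hs => hleft s hs
      right_inv' := fun q hq => hright q hq.1
      open_source := hU.preimage hπs.continuous
      open_target := hU.prod isOpen_univ
      continuousOn_toFun := hfwd.continuousOn
      continuousOn_invFun := hbwd.continuousOn
      baseSet := U
      open_baseSet := hU
      source_eq := rfl
      target_eq := rfl
      proj_toFun := fun _ _ => rfl }
  exact ⟨e, mem_source_adapted (m := 2 * n) (ι x₀), hfwd, hbwd⟩

end Converse

theorem isBase_of_isElliptic [T2Space X] [IsManifold (𝓡 (2 * n)) ∞ X] [CompactSpace X]
    [ConnectedSpace X] {ι : X → OrientedPlane V} (hι : IsGrassmannImmersion n ι)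
    (hell : IsElliptic n ι) : IsBaseOfGreatCircleFibration n ι := by
  have hex : ∀ v : V, ∃ x, v ≠ 0 → ∀ y, v ∈ (ι y).plane ↔ x = y := by
    intro v
    -- The zero vector lies in every plane; its value under `π` is an arbitrary point.
    by_cases hv : v = 0
    · obtain ⟨x⟩ : Nonempty X := inferInstance
      exact ⟨x, fun h => absurd hv h⟩
    · obtain ⟨x, hx, hu⟩ := existsUnique_mem_plane n hι hell hv
      refine ⟨x, fun _ y => ⟨fun h => (hu y h).symm, ?_⟩⟩
      rintro rfl
      exact hx
  choose π hπ using hex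
  have hfib : ∀ x : X, (fun s : sphere (0 : V) 1 => π s) ⁻¹' {x} = greatCircle (ι x) := by
    intro x
    ext s
    exact (hπ s (ne_zero_of_mem_unit_sphere s) x).symm
  exact ⟨fun s => π s, ⟨fun x => exists_trivialization n hι hπ hell x,
    fun x => ⟨ι x, hfib x⟩⟩, hfib⟩

end Equivalence

theorem mainTheorem3 (n : ℕ)
    {V : Type*} [NormedAddCommGroup V] [InnerProductSpace ℝ V] [Fact (finrank ℝ V = 2 * n + 1 + 1)]
    {X : Type*} [TopologicalSpace X] [T2Space X] [SecondCountableTopology X]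
    [ChartedSpace (EuclideanSpace ℝ (Fin (2 * n))) X] [IsManifold (𝓡 (2 * n)) ∞ X]
    (ι : X → OrientedPlane V) (hι : IsGrassmannImmersion n ι) :
    IsBaseOfGreatCircleFibration n ι ↔ IsElliptic n ι ∧ CompactSpace X ∧ ConnectedSpace X := by
  refine ⟨isElliptic_and_of_isBase n hι, ?_⟩
  rintro ⟨hell, _, _⟩
  exact isBase_of_isElliptic n hι hell
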